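/- Let $n\ge 1$ and let $M$ be a smooth manifold of dimension $2n+1$, not necessarily compact. Let $(\alpha,\omega,g)$ be an almost contact metric structure on $M$: $g$ is a Riemannian metric, $\alpha$ is a $1$-form and $\omega$ is a $2$-form, and there are a vector field $\xi$ and an endomorphism $\phi$ of $TM$ with $$\alpha(\xi)=1,\quad \phi^2=-\mathrm{Id}+\xi\otimes\alpha,\quad g(\phi X,\phi Y)=g(X,Y)-\alpha(X)\alpha(Y),\quad \omega(X,Y)=g(\phi X,Y)$$ for all $X,Y$. Assume that the structure is almost cokähler, i.e. $d\alpha=0$ and $d\omega=0$, and that $g$ is Einstein, i.e. $\mathrm{Ric}=\tau g$ for a constant $\tau\in\mathbb R$. Let $R(X,Y)Z=\nabla_X\nabla_YZ-\nabla_Y\nabla_XZ-\nabla_{[X,Y]}Z$ be the curvature of the Levi-Civita connection $\nabla$ of $g$, let $$\rho^*(X,Y)=\sum_i g\bigl(R(X,e_i)(\phi e_i),Y\bigr)$$ for a local orthonormal frame $(e_i)$ of $TM$ (the $*$-Ricci form), and let $\tau^*=\frac1n\langle\omega,\rho^*\rangle$, a function on $M$, where $\langle\cdot,\cdot\rangle$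 is the inner product on $2$-forms for which the forms $e^i\wedge e^j$, $i<j$, are orthonormal. Then at every point of $M$ $$0\le-\tau\le 2n(\tau^*-\tau).$$ In particular, the scalar curvature $s=(2n+1)\tau$ of $g$ is non-positive. -/

import Mathlib

open scoped Manifold ContDiff

noncomputable section

namespace CK

/-! ### Local Riemannian geometry on a normed space

`G y` is the metric at the point `y`, read in a chart with values in `E`. -/

section Local

variable {E : Type*} [NormedAddCommGroup E] [NormedSpace ℝ E]

/-- The Christoffel symbols `Γ_y(u, v) = Γ^k_{ij} u^i v^j ∂_k` of the metric `G`, i.e. the vector with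
`G_y(Γ_y(u, v), w) = (∂_u G(v, w) + ∂_v G(u, w) - ∂_w G(u, v)) / 2` for all `w`.
Here `(G y).inverse` is the musical isomorphism `E* → E` (the inverse metric). -/
def christoffel (G : E → E →L[ℝ] E →L[ℝ] ℝ) (y u v : E) : E :=
  (G y).inverse ((1 / 2 : ℝ) •
    (fderiv ℝ G y u v + fderiv ℝ G y v u - ((fderiv ℝ G y).flip u).flip v))

/-- The Levi-Civita covariant derivative `∇_X Y` of the metric `G`, for vector fields on (an open
subset of) `E`. -/
def nabla (G : E → E →L[ℝ] E →L[ℝ] ℝ) (X Y : E → E) (y : E) : E :=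
  fderiv ℝ Y y (X y) + christoffel G y (X y) (Y y)

/-- `R(X, Y) Z = ∇_X ∇_Y Z - ∇_Y ∇_X Z - ∇_{[X, Y]} Z` for vector fields on (an open subset
of) `E`. -/
def curvatureField (G : E → E →L[ℝ] E →L[ℝ] ℝ) (X Y Z : E → E) : E → E :=
  nabla G X (nabla G Y Z) - nabla G Y (nabla G X Z) - nabla G (VectorField.lieBracket ℝ X Y) Z

/-- The curvature tensor of `G` at `y`: the vectors are extended to constant (that is,
constant-coefficient) vector fields. -/
def localCurvature (G : E → E →L[ℝ] E →L[ℝ] ℝ) (y u v w : E) : E :=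
  curvatureField G (fun _ => u) (fun _ => v) (fun _ => w) y

end Local

/-! ### Riemannian metrics and differential forms on a manifold of dimension `m` -/

section Global

variable {m : ℕ} {M : Type*} [TopologicalSpace M] [ChartedSpace (EuclideanSpace ℝ (Fin m)) M]

/-- The differential at `y` of the inverse of the preferred chart at `p`. -/
abbrev chartInvDeriv (p : M) (y : EuclideanSpace ℝ (Fin m)) :
    EuclideanSpace ℝ (Fin m) →L[ℝ] TangentSpace (𝓡 m) ((extChartAt (𝓡 m) p).symm y) :=
  mfderiv 𝓘(ℝ, EuclideanSpace ℝ (Fin m)) (𝓡 m) (extChartAt (𝓡 m) p).symm y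

/-- A (not necessarily smooth) differential `k`-form on `M`. -/
abbrev DiffForm (m k : ℕ) (M : Type*) [TopologicalSpace M]
    [ChartedSpace (EuclideanSpace ℝ (Fin m)) M] : Type _ :=
  ∀ x : M, TangentSpace (𝓡 m) x [⋀^Fin k]→L[ℝ] ℝ

/-- The coordinate expression of a differential form in the preferred chart at `p`: its pullback
under the inverse of the chart. Only its values on the target of the chart are meaningful. -/
def DiffForm.inChart {k : ℕ} (η : DiffForm m k M) (p : M) (y : EuclideanSpace ℝ (Fin m)) :
    EuclideanSpace ℝ (Fin m) [⋀^Fin k]→L[ℝ] ℝ :=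
  (η ((extChartAt (𝓡 m) p).symm y)).compContinuousLinearMap (chartInvDeriv p y)

/-- A differential form is smooth if its coordinate expressions are. -/
def DiffForm.IsSmooth {k : ℕ} (η : DiffForm m k M) : Prop :=
  ∀ p : M, ContDiffOn ℝ ∞ (η.inChart p) (extChartAt (𝓡 m) p).target

/-- `dη = 0`: the exterior derivatives of the coordinate expressions of `η` vanish. -/
def DiffForm.IsClosed {k : ℕ} (η : DiffForm m k M) : Prop :=
  ∀ p : M, ∀ y ∈ (extChartAt (𝓡 m) p).target, extDeriv (η.inChart p) y = 0

variable [IsManifold (𝓡 m) ∞ M]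

/-- Smooth Riemannian metrics on `M`. -/
abbrev Metric (m : ℕ) (M : Type*) [TopologicalSpace M]
    [ChartedSpace (EuclideanSpace ℝ (Fin m)) M] [IsManifold (𝓡 m) ∞ M] : Type _ :=
  Bundle.ContMDiffRiemannianMetric (𝓡 m) ∞ (EuclideanSpace ℝ (Fin m))
    (fun x : M => TangentSpace (𝓡 m) x)

/-- The coordinate expression of a metric in the preferred chart at `p`. Only its values on the
target of the chart are meaningful. -/
def metricInChart (g : Metric m M) (p : M) (y : EuclideanSpace ℝ (Fin m)) :
    EuclideanSpace ℝ (Fin m) →L[ℝ] EuclideanSpace ℝ (Fin m) →L[ℝ] ℝ :=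
  (ContinuousLinearMap.precomp ℝ (chartInvDeriv p y)).comp
    ((g.inner ((extChartAt (𝓡 m) p).symm y)).comp (chartInvDeriv p y))

@[simp]
theorem metricInChart_apply (g : Metric m M) (p : M) (y u v : EuclideanSpace ℝ (Fin m)) :
    metricInChart g p y u v =
      g.inner ((extChartAt (𝓡 m) p).symm y) (chartInvDeriv p y u) (chartInvDeriv p y v) :=
  rfl

/-- The Riemann curvature tensor `R(u, v) w` at `p` of the Levi-Civita connection of `g`, computed
in the preferred chart at `p`, with the sign convention
`R(X, Y) Z = ∇_X ∇_Y Z - ∇_Y ∇_X Z - ∇_{[X, Y]} Z`. -/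
def curvature (g : Metric m M) (p : M) (u v w : TangentSpace (𝓡 m) p) : TangentSpace (𝓡 m) p :=
  let d : TangentSpace (𝓡 m) p →L[ℝ] EuclideanSpace ℝ (Fin m) :=
    mfderiv (𝓡 m) 𝓘(ℝ, EuclideanSpace ℝ (Fin m)) (extChartAt (𝓡 m) p) p
  chartInvDeriv p (extChartAt (𝓡 m) p p)
    (localCurvature (metricInChart g p) (extChartAt (𝓡 m) p p) (d u) (d v) (d w))

open scoped Bundle in
/-- Each tangent space of a Riemannian manifold has an orthonormal basis. -/
theorem exists_orthonormalFrame (g : Metric m M) (p : M) :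
    ∃ e : Fin m → TangentSpace (𝓡 m) p,
      ∀ i j, g.inner p (e i) (e j) = if i = j then 1 else 0 := by
  let _ : Bundle.RiemannianBundle (fun x : M => TangentSpace (𝓡 m) x) := ⟨g.toRiemannianMetric⟩
  have : FiniteDimensional ℝ (TangentSpace (𝓡 m) p) :=
    inferInstanceAs (FiniteDimensional ℝ (EuclideanSpace ℝ (Fin m)))
  have hd : Module.finrank ℝ (TangentSpace (𝓡 m) p) = m :=
    finrank_euclideanSpace_fin (𝕜 := ℝ) (n := m)
  let b := (stdOrthonormalBasis ℝ (TangentSpace (𝓡 m) p)).reindex (finCongr hd)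
  exact ⟨b, fun i j => orthonormal_iff_ite.mp b.orthonormal i j⟩

/-- An orthonormal basis of `T_p M`. The quantities defined with it below are traces, so they do
not depend on the choice. -/
def frame (g : Metric m M) (p : M) : Fin m → TangentSpace (𝓡 m) p :=
  (exists_orthonormalFrame g p).choose

/-- The Ricci tensor `Ric(u, v) = tr (w ↦ R(w, u) v)`. -/
def ricci (g : Metric m M) (p : M) (u v : TangentSpace (𝓡 m) p) : ℝ :=
  ∑ i, g.inner p (curvature g p (frame g p i) u v) (frame g p i)

/-- The scalar curvature, i.e. the trace of the Ricci tensor. -/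
def scalarCurvature (g : Metric m M) (p : M) : ℝ :=
  ∑ i, ricci g p (frame g p i) (frame g p i)

/-- `g` is Einstein with Einstein constant `τ`: `Ric = τ g`. -/
def IsEinstein (g : Metric m M) (τ : ℝ) : Prop :=
  ∀ (p : M) (u v : TangentSpace (𝓡 m) p), ricci g p u v = τ * g.inner p u v

/-- The inner product on `2`-forms at `p` for which the `e^i ∧ e^j`, `i < j`, are orthonormal. -/
def twoFormInner (g : Metric m M) (p : M)
    (a b : TangentSpace (𝓡 m) p → TangentSpace (𝓡 m) p → ℝ) : ℝ :=
  ∑ i, ∑ j ∈ Finset.Ioi i,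
    a (frame g p i) (frame g p j) * b (frame g p i) (frame g p j)

end Global

/-! ### Almost contact metric structures -/

section Contact

/-- An almost contact metric structure `(α, ω, g)` on a manifold of dimension `2n + 1`, together
with its Reeb field `ξ` and its endomorphism `φ` (equal to `J` on `ker α`, and `φ ξ = 0`).
The tensors `ξ` and `φ` are determined by `(α, ω, g)` (they are the metric duals of `α` and `ω`);
in particular they are smooth. The identities say that pointwise there is an orthonormal coframe
with `α = e^{2n+1}` and `ω = e^{12} + e^{34} + ⋯ + e^{2n-1,2n}`; so `α ∧ ω^n` is a volume form. -/
structure AlmostContactMetricStructure (n : ℕ) (M : Type*) [TopologicalSpace M]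
    [ChartedSpace (EuclideanSpace ℝ (Fin (2 * n + 1))) M]
    [IsManifold (𝓡 (2 * n + 1)) ∞ M] where
  /-- the Riemannian metric `g` -/
  g : Metric (2 * n + 1) M
  /-- the `1`-form `α` -/
  alpha : DiffForm (2 * n + 1) 1 M
  /-- the `2`-form `ω` -/
  omega : DiffForm (2 * n + 1) 2 M
  /-- the Reeb vector field `ξ` -/
  xi : ∀ x : M, TangentSpace (𝓡 (2 * n + 1)) x
  /-- the endomorphism `φ` -/
  phi : ∀ x : M, TangentSpace (𝓡 (2 * n + 1)) x →L[ℝ] TangentSpace (𝓡 (2 * n + 1)) x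
  smooth_alpha : alpha.IsSmooth
  smooth_omega : omega.IsSmooth
  alpha_xi : ∀ x, alpha x ![xi x] = 1
  phi_phi : ∀ x v, phi x (phi x v) = -v + alpha x ![v] • xi x
  g_phi_phi : ∀ x u v, g.inner x (phi x u) (phi x v) = g.inner x u v - alpha x ![u] * alpha x ![v]
  omega_eq : ∀ x u v, omega x ![u, v] = g.inner x (phi x u) v

variable {n : ℕ} {M : Type*} [TopologicalSpace M]
  [ChartedSpace (EuclideanSpace ℝ (Fin (2 * n + 1))) M] [IsManifold (𝓡 (2 * n + 1)) ∞ M]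

namespace AlmostContactMetricStructure

/-- An almost contact metric structure is almost cokähler if `α` and `ω` are closed. -/
def IsAlmostCokahler (S : AlmostContactMetricStructure n M) : Prop :=
  S.alpha.IsClosed ∧ S.omega.IsClosed

/-- The `*`-Ricci form `ρ*(u, v) = ∑_i g(R(u, e_i)(J e_i), v)`. As `φ ξ = 0`, the sum over an
orthonormal basis of `ker α` is the sum over one of the tangent space, with `φ` for `J`. -/
def starRicciForm (S : AlmostContactMetricStructure n M) (p : M)
    (u v : TangentSpace (𝓡 (2 * n + 1)) p) : ℝ :=
  ∑ i, S.g.inner p (curvature S.g p u (frame S.g p i) (S.phi p (frame S.g p i))) v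

/-- The function `τ* = (1 / n) ⟨ω, ρ*⟩`. -/
def tauStar (S : AlmostContactMetricStructure n M) (p : M) : ℝ :=
  (1 / (n : ℝ)) * twoFormInner S.g p (fun u v => S.omega p ![u, v]) (S.starRicciForm p)

end AlmostContactMetricStructure

end Contact

end CK

end

noncomputable section

namespace CK

/-! ### Traces of endomorphisms and skew-symmetry with respect to a bilinear form -/

section LinearAlgebra

variable {E : Type*} [NormedAddCommGroup E] [NormedSpace ℝ E]
  {g : E →L[ℝ] E →L[ℝ] ℝ}

/-! Write `A = ∇ξ` and `B = ∇φ`. Both inequalities come from computing two norms by Bochner-type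
arguments and comparing them pointwise. Closedness of `α` makes `A` self-adjoint, and `|ξ| = 1` then
gives `A ξ = 0`. Closedness of `ω` makes the cyclic sum of `g(B_u v, w)` vanish. Combined with the
derivatives of `φ ξ = 0` and `φ² = -1 + ξ ⊗ α`, this gives `tr A = 0` and `div φ = 0`: both forms
are harmonic. Commuting derivatives of `ξ` yields `Ric(ξ, ξ) = -|A|²` (`ricci_xi`), so `-τ = |A|² ≥
0` for an Einstein metric. Commuting derivatives of `φ` yields the Weitzenböck formula `|B|² = 4⟨ω,
ρ*⟩ - 4nτ` (`sum_metric_covEnd` with `two_mul_twoFormInner`). The comparison is algebraic. Each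
`B_x` is skew and `B_x ξ = -φ A x` has the length of `A x`, so `|B_x|² ≥ 2|A x|²`
(`two_mul_metric_le_sum`). Summing over a frame gives `|B|² ≥ 2|A|² = -2τ`, which is the upper bound
on `-τ`. Every identity is local, so the analysis takes place on an open set of a vector space, with
Christoffel symbols as a field of bilinear maps; charts then carry the result to `M`. -/

theorem eq_of_forall_metric_eq (hpos : ∀ v, v ≠ 0 → 0 < g v v) {a b : E}
    (h : ∀ w, g a w = g b w) : a = b := by
  by_contra hab
  have := hpos (a - b) (sub_ne_zero.mpr hab)
  rw [map_sub g a b, sub_apply, h, sub_self] at this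
  exact lt_irrefl _ this

variable [FiniteDimensional ℝ E]

/-- The trace of continuous endomorphisms, as a continuous linear functional. -/
def traceCLM (E : Type*) [NormedAddCommGroup E] [NormedSpace ℝ E] [FiniteDimensional ℝ E] :
    (E →L[ℝ] E) →L[ℝ] ℝ :=
  LinearMap.toContinuousLinearMap ((LinearMap.trace ℝ E).comp (ContinuousLinearMap.coeLM ℝ))

theorem traceCLM_apply (T : E →L[ℝ] E) : traceCLM E T = LinearMap.trace ℝ E (T : E →ₗ[ℝ] E) := rfl

theorem traceCLM_comp_comm (S T : E →L[ℝ] E) : traceCLM E (S ∘L T) = traceCLM E (T ∘L S) :=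
  LinearMap.trace_mul_comm ℝ (S : E →ₗ[ℝ] E) (T : E →ₗ[ℝ] E)

theorem traceCLM_smulRight (f : E →L[ℝ] ℝ) (v : E) : traceCLM E (f.smulRight v) = f v := by
  rw [traceCLM_apply]
  exact LinearMap.trace_smulRight (f : E →ₗ[ℝ] ℝ) v

/-- The isomorphism `g : E → E*` conjugates `S` into the transpose of `T`, and a transpose has the
same trace. -/
theorem traceCLM_eq_of_adjoint (hpos : ∀ v, v ≠ 0 → 0 < g v v) {S T : E →L[ℝ] E}
    (h : ∀ u v, g (S u) v = g u (T v)) : traceCLM E S = traceCLM E T := by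
  let f : E →ₗ[ℝ] Module.Dual ℝ E := (ContinuousLinearMap.coeLM ℝ).comp (g : E →ₗ[ℝ] E →L[ℝ] ℝ)
  have hf : Function.Injective f := fun a b hab =>
    eq_of_forall_metric_eq hpos fun w => LinearMap.congr_fun hab w
  let e : E ≃ₗ[ℝ] Module.Dual ℝ E :=
    LinearEquiv.ofInjectiveOfFinrankEq f hf (Subspace.dual_finrank_eq).symm
  have he : ∀ u v, e u v = g u v := fun u v => rfl
  have key : Module.Dual.transpose (R := ℝ) (T : E →ₗ[ℝ] E) = e.conj (S : E →ₗ[ℝ] E) := by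
    ext l v
    obtain ⟨u, rfl⟩ := e.surjective l
    simp only [LinearEquiv.conj_apply, LinearMap.comp_apply, LinearEquiv.coe_coe,
      LinearEquiv.symm_apply_apply, he, ContinuousLinearMap.coe_coe, h]
    rfl
  rw [traceCLM_apply, traceCLM_apply, ← LinearMap.trace_transpose' (T : E →ₗ[ℝ] E), key,
    LinearMap.trace_conj']

/-- Positivity gives injectivity, and the dimensions agree. This ensures that `inverse` in the
Christoffel symbols is a true inverse and not its default value `0`. -/
theorem isInvertible_of_posDef (hpos : ∀ v, v ≠ 0 → 0 < g v v) : g.IsInvertible := by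
  have hf : Function.Injective (g : E →ₗ[ℝ] E →L[ℝ] ℝ) := fun a b hab =>
    eq_of_forall_metric_eq hpos fun w => DFunLike.congr_fun (F := E →L[ℝ] ℝ) hab w
  have hd : Module.finrank ℝ E = Module.finrank ℝ (E →L[ℝ] ℝ) := by
    rw [← (LinearMap.toContinuousLinearMap (𝕜 := ℝ) (E := E) (F' := ℝ)).finrank_eq]
    exact (Subspace.dual_finrank_eq).symm
  exact ⟨(LinearEquiv.ofInjectiveOfFinrankEq _ hf hd).toContinuousLinearEquiv, by ext; rfl⟩

theorem metric_inverse_apply (hpos : ∀ v, v ≠ 0 → 0 < g v v) (l : E →L[ℝ] ℝ) :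
    g (g.inverse l) = l :=
  (isInvertible_of_posDef hpos).self_apply_inverse l

section Frame

variable {ι : Type*} [Fintype ι] [DecidableEq ι] {e : ι → E}

theorem sum_frame (he : ∀ i j, g (e i) (e j) = if i = j then 1 else 0)
    (hd : Fintype.card ι = Module.finrank ℝ E) (v : E) :
    v = ∑ i, g v (e i) • e i := by
  have hli : LinearIndependent ℝ e := by
    rw [Fintype.linearIndependent_iff]
    intro c hc j
    have := congrArg (fun w => g w (e j)) hc
    simpa [he, sum_apply] using this
  let b := basisOfLinearIndependentOfCardEqFinrank' e hli hd
  have hb : ∀ i, b i = e i := fun i => by simp [b]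
  have h1 := b.sum_repr v
  have h2 : ∀ j, g v (e j) = b.repr v j := by
    intro j
    conv_lhs => rw [← h1]
    simp [hb, he]
  simp only [h2]
  simpa [hb] using h1.symm

theorem traceCLM_eq_sum (he : ∀ i j, g (e i) (e j) = if i = j then 1 else 0)
    (hd : Fintype.card ι = Module.finrank ℝ E) (T : E →L[ℝ] E) :
    traceCLM E T = ∑ i, g (T (e i)) (e i) := by
  have hT : T = ∑ i, ((g.flip (e i)) ∘L T).smulRight (e i) := by
    ext v
    rw [sum_apply]
    exact sum_frame he hd (T v)
  conv_lhs => rw [hT]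
  simp [map_sum, traceCLM_smulRight]

theorem sum_metric_mul (he : ∀ i j, g (e i) (e j) = if i = j then 1 else 0)
    (hd : Fintype.card ι = Module.finrank ℝ E) (u v : E) :
    ∑ i, g u (e i) * g v (e i) = g u v := by
  conv_rhs => rw [sum_frame he hd v]
  simp [mul_comm]

theorem sum_metric_mul_sum (he : ∀ i j, g (e i) (e j) = if i = j then 1 else 0)
    (hd : Fintype.card ι = Module.finrank ℝ E) {κ : Type*} [Fintype κ] (v : E) (a : κ → E) :
    ∑ i, g v (e i) * ∑ k, g (a k) (e i) = ∑ k, g (a k) v := by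
  simp only [Finset.mul_sum]
  rw [Finset.sum_comm]
  exact Finset.sum_congr rfl fun k _ =>
    (Finset.sum_congr rfl fun i _ => mul_comm _ _).trans (sum_metric_mul he hd (a k) v)

/-- A skew endomorphism `B` satisfies `|B|² ≥ 2 |B ξ|²` for each unit vector `ξ`. -/
theorem two_mul_metric_le_sum (he : ∀ i j, g (e i) (e j) = if i = j then 1 else 0)
    (hd : Fintype.card ι = Module.finrank ℝ E) (hpos : ∀ v, v ≠ 0 → 0 < g v v)
    (hsymm : ∀ u v, g u v = g v u) {B : E →L[ℝ] E} (hB : ∀ u v, g (B u) v = -g u (B v))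
    {ξ : E} (hξ : g ξ ξ = 1) :
    2 * g (B ξ) (B ξ) ≤ ∑ i, g (B (e i)) (B (e i)) := by
  have hnn : ∀ v, 0 ≤ g v v := fun v => by
    rcases eq_or_ne v 0 with rfl | hv
    · simp
    · exact (hpos v hv).le
  set ζ := B ξ with hζ
  have hξζ : g ξ ζ = 0 := by
    have h1 := hB ξ ξ
    have h2 := hsymm (B ξ) ξ
    rw [hζ]; linarith
  -- Subtract from `B` the skew rank-two map `v ↦ g(ξ, v) ζ - g(ζ, v) ξ`. The remainder kills `ξ`,
  -- and its squared norm is `|B|² - 2|ζ|²`.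
  have h0 : 0 ≤ ∑ i, g (B (e i) - g ξ (e i) • ζ + g ζ (e i) • ξ)
      (B (e i) - g ξ (e i) • ζ + g ζ (e i) • ξ) := Finset.sum_nonneg fun i _ => hnn _
  have h1 : ∀ i, g (B (e i) - g ξ (e i) • ζ + g ζ (e i) • ξ)
      (B (e i) - g ξ (e i) • ζ + g ζ (e i) • ξ) =
      g (B (e i)) (B (e i)) + (g ξ (e i) * g ξ (e i)) * g ζ ζ + g ζ (e i) * g ζ (e i)
        + 2 * (g ξ (e i) * g (B ζ) (e i)) - 2 * (g ζ (e i) * g ζ (e i)) := by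
    intro i
    have h3 : g (B (e i)) ζ = - g (B ζ) (e i) := by rw [hB, hsymm (e i)]
    have h4 : g (B (e i)) ξ = - g ζ (e i) := by rw [hB, hsymm (e i)]
    simp only [map_add, map_sub, map_smul, add_apply,
      sub_apply, smul_apply, smul_eq_mul,
      hsymm ζ (B (e i)), hsymm ξ (B (e i)), h3, h4, hξ, hξζ, hsymm ζ ξ]
    ring
  simp only [h1, Finset.sum_add_distrib, Finset.sum_sub_distrib, ← Finset.mul_sum,
    ← Finset.sum_mul, sum_metric_mul he hd] at h0
  have h5 : g ξ (B ζ) = - g ζ ζ := by have := hB ξ ζ; rw [← hζ] at this; linarith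
  rw [h5, hξ] at h0
  linarith

end Frame

end LinearAlgebra

/-! ### Charts, coordinate vector fields and smoothness of the metric coefficients -/

section Chart
open Bundle

variable {m : ℕ} {M : Type*} [TopologicalSpace M] [ChartedSpace (EuclideanSpace ℝ (Fin m)) M]
  [IsManifold (𝓡 m) ∞ M]

/-- The differential at `q` of the preferred chart at `p`. -/
abbrev chartDeriv (p q : M) : TangentSpace (𝓡 m) q →L[ℝ] EuclideanSpace ℝ (Fin m) :=
  mfderiv (𝓡 m) 𝓘(ℝ, EuclideanSpace ℝ (Fin m)) (extChartAt (𝓡 m) p) q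

theorem isManifold_one : IsManifold (𝓡 m) 1 M := IsManifold.of_le (n := ∞) (by simp)

theorem chartDeriv_chartInvDeriv {p : M} {y : EuclideanSpace ℝ (Fin m)}
    (hy : y ∈ (extChartAt (𝓡 m) p).target) (v : EuclideanSpace ℝ (Fin m)) :
    chartDeriv p ((extChartAt (𝓡 m) p).symm y) (chartInvDeriv p y v) = v := by
  have := isManifold_one (m := m) (M := M)
  have h := mfderiv_extChartAt_comp_mfderivWithin_extChartAt_symm (I := 𝓡 m) hy
  simp only [modelWithCornersSelf_coe, Set.range_id, mfderivWithin_univ] at h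
  exact DFunLike.congr_fun h v

theorem chartInvDeriv_chartDeriv {p : M} {y : EuclideanSpace ℝ (Fin m)}
    (hy : y ∈ (extChartAt (𝓡 m) p).target)
    (v : TangentSpace (𝓡 m) ((extChartAt (𝓡 m) p).symm y)) :
    chartInvDeriv p y (chartDeriv p ((extChartAt (𝓡 m) p).symm y) v) = v := by
  have := isManifold_one (m := m) (M := M)
  have h := mfderivWithin_extChartAt_symm_comp_mfderiv_extChartAt (I := 𝓡 m) hy
  simp only [modelWithCornersSelf_coe, Set.range_id, mfderivWithin_univ] at h
  exact DFunLike.congr_fun h v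

/-- Coordinate vector fields are smooth because they are the tangent map of the inverse chart
applied to a constant field. -/
theorem contMDiffOn_chartInvDeriv (p : M) (v : EuclideanSpace ℝ (Fin m)) :
    ContMDiffOn 𝓘(ℝ, EuclideanSpace ℝ (Fin m)) ((𝓡 m).prod 𝓘(ℝ, EuclideanSpace ℝ (Fin m))) ∞
      (fun y => TotalSpace.mk' (EuclideanSpace ℝ (Fin m)) (E := fun x : M => TangentSpace (𝓡 m) x)
        ((extChartAt (𝓡 m) p).symm y) (chartInvDeriv p y v)) (extChartAt (𝓡 m) p).target := by
  have := isManifold_one (m := m) (M := M)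
  have ho : IsOpen (extChartAt (𝓡 m) p).target := isOpen_extChartAt_target p
  have h1 := (contMDiffOn_extChartAt_symm (I := 𝓡 m) (n := ∞) p).contMDiffOn_tangentMapWithin
    (m := ∞) (by simp) ho.uniqueMDiffOn
  have h2 : ContMDiff 𝓘(ℝ, EuclideanSpace ℝ (Fin m))
      (𝓘(ℝ, EuclideanSpace ℝ (Fin m)).prod 𝓘(ℝ, EuclideanSpace ℝ (Fin m))) ∞
      (fun y => (⟨y, v⟩ : TangentBundle 𝓘(ℝ, EuclideanSpace ℝ (Fin m))
        (EuclideanSpace ℝ (Fin m)))) :=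
    contMDiff_vectorSpace_iff_contDiff.mpr contDiff_const
  refine (h1.comp h2.contMDiffOn fun y hy => hy).congr fun y hy => ?_
  simp only [Function.comp_apply, tangentMapWithin, mfderivWithin_of_isOpen ho hy]
  rfl

theorem contDiffOn_metricInChart (g : Metric m M) (p : M) :
    ContDiffOn ℝ ∞ (metricInChart g p) (extChartAt (𝓡 m) p).target := by
  rw [contDiffOn_clm_apply]
  intro u
  rw [contDiffOn_clm_apply]
  intro v
  have hg : ContMDiffOn 𝓘(ℝ, EuclideanSpace ℝ (Fin m)) _ ∞ _ (extChartAt (𝓡 m) p).target :=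
    g.contMDiff.comp_contMDiffOn (contMDiffOn_extChartAt_symm (I := 𝓡 m) (n := ∞) p)
  intro y hy
  have := ContMDiffWithinAt.clm_bundle_apply₂ (F₁ := EuclideanSpace ℝ (Fin m))
    (F₂ := EuclideanSpace ℝ (Fin m)) (F₃ := ℝ) (E₃ := Bundle.Trivial M ℝ) (hg y hy)
    (contMDiffOn_chartInvDeriv p u y hy) (contMDiffOn_chartInvDeriv p v y hy)
  rw [contMDiffWithinAt_totalSpace] at this
  exact this.2.contDiffWithinAt

end Chart

/-! ### Covariant derivatives with respect to a connection on an open set -/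

section Connection

open Filter Topology

variable {E : Type*} [NormedAddCommGroup E] [NormedSpace ℝ E]

/-- The covariant derivative `v ↦ ∇_v X` of a vector field, for the connection with Christoffel
symbols `Γ`. -/
def covVec (Γ : E → E →L[ℝ] E →L[ℝ] E) (X : E → E) (y : E) : E →L[ℝ] E :=
  fderiv ℝ X y + (Γ y).flip (X y)

/-- The covariant derivative `v ↦ ∇_v T` of a field of endomorphisms. -/
def covEnd (Γ : E → E →L[ℝ] E →L[ℝ] E) (T : E → E →L[ℝ] E) (y : E) : E →L[ℝ] E →L[ℝ] E :=
  fderiv ℝ T y + (ContinuousLinearMap.compL ℝ E E E).flip (T y) ∘L Γ y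
    - ContinuousLinearMap.compL ℝ E E E (T y) ∘L Γ y

/-- The covariant derivative `∇_x B` of a field of bilinear maps. -/
def covBil (Γ : E → E →L[ℝ] E →L[ℝ] E) (B : E → E →L[ℝ] E →L[ℝ] E) (y x : E) :
    E →L[ℝ] E →L[ℝ] E :=
  fderiv ℝ B y x + ContinuousLinearMap.compL ℝ E E E (Γ y x) ∘L B y - B y ∘L Γ y x
    - (ContinuousLinearMap.compL ℝ E E E).flip (Γ y x) ∘L B y

/-- The curvature endomorphism `R(u, v)`. -/
def curvEnd (Γ : E → E →L[ℝ] E →L[ℝ] E) (y u v : E) : E →L[ℝ] E :=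
  fderiv ℝ Γ y u v - fderiv ℝ Γ y v u + Γ y u ∘L Γ y v - Γ y v ∘L Γ y u

variable {Γ : E → E →L[ℝ] E →L[ℝ] E} {y : E}

theorem covVec_apply (X : E → E) (v : E) :
    covVec Γ X y v = fderiv ℝ X y v + Γ y v (X y) := rfl

theorem covEnd_apply (T : E → E →L[ℝ] E) (v w : E) :
    covEnd Γ T y v w = fderiv ℝ T y v w + Γ y v (T y w) - T y (Γ y v w) := rfl

theorem covBil_apply (B : E → E →L[ℝ] E →L[ℝ] E) (x v w : E) :
    covBil Γ B y x v w =
      fderiv ℝ B y x v w + Γ y x (B y v w) - B y (Γ y x v) w - B y v (Γ y x w) := rfl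

theorem curvEnd_apply (u v w : E) :
    curvEnd Γ y u v w = fderiv ℝ Γ y u v w - fderiv ℝ Γ y v u w
      + Γ y u (Γ y v w) - Γ y v (Γ y u w) := rfl

theorem curvEnd_swap (u v w : E) : curvEnd Γ y u v w = -curvEnd Γ y v u w := by
  simp only [curvEnd_apply]; abel

theorem curvEnd_add_right (u v v' : E) :
    curvEnd Γ y u (v + v') = curvEnd Γ y u v + curvEnd Γ y u v' := by
  ext w
  simp only [curvEnd_apply, map_add, add_apply]
  abel

theorem curvEnd_smul_right (c : ℝ) (u v : E) :
    curvEnd Γ y u (c • v) = c • curvEnd Γ y u v := by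
  ext w
  simp only [curvEnd_apply, map_smul, smul_apply]
  module

section Leibniz

variable {F F' : Type*} [NormedAddCommGroup F] [NormedSpace ℝ F] [NormedAddCommGroup F']
  [NormedSpace ℝ F']

theorem fderiv_apply_const {T : E → F →L[ℝ] F'} (hT : DifferentiableAt ℝ T y) (w : F) (v : E) :
    fderiv ℝ (fun z => T z w) y v = fderiv ℝ T y v w := by
  rw [fderiv_clm_apply hT (differentiableAt_const w)]
  simp

theorem fderiv_apply_field {T : E → F →L[ℝ] F'} {X : E → F} (hT : DifferentiableAt ℝ T y)
    (hX : DifferentiableAt ℝ X y) (v : E) :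
    fderiv ℝ (fun z => T z (X z)) y v = fderiv ℝ T y v (X y) + T y (fderiv ℝ X y v) := by
  rw [fderiv_clm_apply hT hX]
  simp [add_comm]

end Leibniz

theorem covVec_const (w v : E) : covVec Γ (fun _ => w) y v = Γ y v w := by
  simp [covVec_apply]

theorem covVec_congr {X Y : E → E} (h : X =ᶠ[𝓝 y] Y) : covVec Γ X y = covVec Γ Y y := by
  rw [covVec, covVec, h.fderiv_eq, h.eq_of_nhds]

theorem covVec_end {T : E → E →L[ℝ] E} {X : E → E} (hT : DifferentiableAt ℝ T y)
    (hX : DifferentiableAt ℝ X y) (v : E) :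
    covVec Γ (fun z => T z (X z)) y v = covEnd Γ T y v (X y) + T y (covVec Γ X y v) := by
  simp only [covVec_apply, covEnd_apply, fderiv_apply_field hT hX, map_add]
  abel

theorem covVec_end_const {T : E → E →L[ℝ] E} (hT : DifferentiableAt ℝ T y) (w v : E) :
    covVec Γ (fun z => T z w) y v = covEnd Γ T y v w + T y (Γ y v w) := by
  rw [covVec_end hT (differentiableAt_const w), covVec_const]

theorem covVec_bil_const {B : E → E →L[ℝ] E →L[ℝ] E} (hB : DifferentiableAt ℝ B y) (u w x : E) :
    covVec Γ (fun z => B z u w) y x =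
      covBil Γ B y x u w + B y (Γ y x u) w + B y u (Γ y x w) := by
  have h : DifferentiableAt ℝ (fun z => B z u) y := hB.clm_apply (differentiableAt_const u)
  rw [covVec_end_const h, covEnd_apply, covBil_apply, fderiv_apply_const hB]
  abel

theorem covEnd_comp {S T : E → E →L[ℝ] E} (hS : DifferentiableAt ℝ S y)
    (hT : DifferentiableAt ℝ T y) (v : E) :
    covEnd Γ (fun z => S z ∘L T z) y v = covEnd Γ S y v ∘L T y + S y ∘L covEnd Γ T y v := by
  ext w
  have h : DifferentiableAt ℝ (fun z => T z w) y := hT.clm_apply (differentiableAt_const w)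
  have h1 := covVec_end_const (Γ := Γ) (hS.clm_comp hT) w v
  have h2 := covVec_end (Γ := Γ) hS h v
  rw [covVec_end_const hT] at h2
  simp only [ContinuousLinearMap.comp_apply, map_add] at h1 h2
  rw [h1] at h2
  simp only [add_apply, ContinuousLinearMap.comp_apply]
  rw [← add_right_cancel_iff (a := S y (T y (Γ y v w))), h2]
  abel

/-- A vector frozen in coordinates is not parallel: the extra term is `B` applied to its covariant
derivative `Γ y x u`. -/
theorem covEnd_bil_apply {B : E → E →L[ℝ] E →L[ℝ] E} (hB : DifferentiableAt ℝ B y) (u x : E) :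
    covEnd Γ (fun z => B z u) y x = covBil Γ B y x u + B y (Γ y x u) := by
  ext w
  simp only [covEnd_apply, covBil_apply, add_apply, fderiv_apply_const hB]
  abel

theorem covEnd_bil_flip {B : E → E →L[ℝ] E →L[ℝ] E} (hB : DifferentiableAt ℝ B y) (w x : E) :
    covEnd Γ (fun z => (B z).flip w) y x = (covBil Γ B y x).flip w + (B y).flip (Γ y x w) := by
  have h : DifferentiableAt ℝ (fun z => (B z).flip) y :=
    (ContinuousLinearMap.flipₗᵢ ℝ E E E).toContinuousLinearEquiv.differentiableAt.comp y hB
  have h' : DifferentiableAt ℝ (fun z => (B z).flip w) y := h.clm_apply (differentiableAt_const w)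
  ext u
  have h2 : fderiv ℝ (fun z => (B z).flip w) y x u = fderiv ℝ B y x u w := by
    rw [← fderiv_apply_const h' u x, ← fderiv_apply_const hB u x,
      ← fderiv_apply_const (hB.clm_apply (differentiableAt_const u)) w x]
    rfl
  simp only [covEnd_apply, covBil_apply, add_apply, h2, ContinuousLinearMap.flip_apply]
  abel

/-- The connection enters `covEnd` only through a commutator, which has no trace. -/
theorem fderiv_traceCLM [FiniteDimensional ℝ E] {T : E → E →L[ℝ] E} (hT : DifferentiableAt ℝ T y)
    (v : E) : fderiv ℝ (fun z => traceCLM E (T z)) y v = traceCLM E (covEnd Γ T y v) := by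
  have h1 : fderiv ℝ (fun z => traceCLM E (T z)) y v = traceCLM E (fderiv ℝ T y v) := by
    have := ((traceCLM E).hasFDerivAt.comp y hT.hasFDerivAt).fderiv
    exact DFunLike.congr_fun this v
  have h2 : covEnd Γ T y v = fderiv ℝ T y v + Γ y v ∘L T y - T y ∘L Γ y v := rfl
  rw [h1, h2, map_sub, map_add, traceCLM_comp_comm (Γ y v)]
  abel

/-! ### The Ricci and Bianchi identities -/

/-- In `∇²_{u,v} X - ∇²_{v,u} X` the flat second derivatives cancel by Schwarz and the terms in
`Γ(u, v)` by vanishing torsion; what remains is curvature. -/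
theorem covEnd_covVec_sub {X : E → E} (hX : ContDiffAt ℝ 2 X y) (hΓ : DifferentiableAt ℝ Γ y)
    (hs : ∀ u v, Γ y u v = Γ y v u) (u v : E) :
    covEnd Γ (covVec Γ X) y u v - covEnd Γ (covVec Γ X) y v u = curvEnd Γ y u v (X y) := by
  have hX1 : DifferentiableAt ℝ X y := hX.differentiableAt (by simp)
  have hX2 : DifferentiableAt ℝ (fderiv ℝ X) y :=
    (hX.fderiv_right (m := 1) (by norm_num)).differentiableAt (by simp)
  have hf : DifferentiableAt ℝ (fun z => (Γ z).flip) y :=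
    (ContinuousLinearMap.flipₗᵢ ℝ E E E).toContinuousLinearEquiv.differentiableAt.comp y hΓ
  have hA : DifferentiableAt ℝ (covVec Γ X) y := hX2.add (hf.clm_apply hX1)
  have key : ∀ u v, fderiv ℝ (covVec Γ X) y u v =
      fderiv ℝ (fderiv ℝ X) y u v + fderiv ℝ Γ y u v (X y) + Γ y v (fderiv ℝ X y u) := by
    intro u v
    have hΓv : DifferentiableAt ℝ (fun z => Γ z v) y := hΓ.clm_apply (differentiableAt_const v)
    have h1 : (fun z => covVec Γ X z v) = (fun z => fderiv ℝ X z v) + fun z => Γ z v (X z) := rfl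
    rw [← fderiv_apply_const hA, h1,
      fderiv_add (hX2.clm_apply (differentiableAt_const v)) (hΓv.clm_apply hX1), add_apply,
      fderiv_apply_const hX2, fderiv_apply_field hΓv hX1, fderiv_apply_const hΓ]
    abel
  have hsymm : fderiv ℝ (fderiv ℝ X) y u v = fderiv ℝ (fderiv ℝ X) y v u :=
    (hX.isSymmSndFDerivAt (by simp)).eq u v
  simp only [covEnd_apply, key, covVec_apply, curvEnd_apply, map_add, hs v u, hsymm]
  abel

/-- The same cancellation for endomorphisms, on which curvature acts by the commutator `[R(u, v),
T]`. -/
theorem covBil_covEnd_sub {T : E → E →L[ℝ] E} (hT : ContDiffAt ℝ 2 T y)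
    (hΓ : DifferentiableAt ℝ Γ y) (hs : ∀ u v, Γ y u v = Γ y v u) (u v w : E) :
    covBil Γ (covEnd Γ T) y u v w - covBil Γ (covEnd Γ T) y v u w =
      curvEnd Γ y u v (T y w) - T y (curvEnd Γ y u v w) := by
  have hT1 : DifferentiableAt ℝ T y := hT.differentiableAt (by simp)
  have hT2 : DifferentiableAt ℝ (fderiv ℝ T) y :=
    (hT.fderiv_right (m := 1) (by norm_num)).differentiableAt (by simp)
  have hB : DifferentiableAt ℝ (covEnd Γ T) y := by
    have h1 : DifferentiableAt ℝ (fun z => (ContinuousLinearMap.compL ℝ E E E).flip (T z)) y :=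
      ((ContinuousLinearMap.compL ℝ E E E).flip).differentiableAt.comp y hT1
    have h2 : DifferentiableAt ℝ (fun z => (ContinuousLinearMap.compL ℝ E E E) (T z)) y :=
      ((ContinuousLinearMap.compL ℝ E E E)).differentiableAt.comp y hT1
    exact (hT2.add (h1.clm_comp hΓ)).sub (h2.clm_comp hΓ)
  have key : ∀ u v w, fderiv ℝ (covEnd Γ T) y u v w =
      fderiv ℝ (fderiv ℝ T) y u v w + (fderiv ℝ Γ y u v (T y w) + Γ y v (fderiv ℝ T y u w))
        - (fderiv ℝ T y u (Γ y v w) + T y (fderiv ℝ Γ y u v w)) := by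
    intro u v w
    have hΓv : DifferentiableAt ℝ (fun z => Γ z v) y := hΓ.clm_apply (differentiableAt_const v)
    have hΓvw : DifferentiableAt ℝ (fun z => Γ z v w) y := hΓv.clm_apply (differentiableAt_const w)
    have hTw : DifferentiableAt ℝ (fun z => T z w) y := hT1.clm_apply (differentiableAt_const w)
    have hDv : DifferentiableAt ℝ (fun z => fderiv ℝ T z v) y :=
      hT2.clm_apply (differentiableAt_const v)
    have h1 : (fun z => covEnd Γ T z v w) =
      ((fun z => fderiv ℝ T z v w) + fun z => Γ z v (T z w)) - fun z => T z (Γ z v w) := rfl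
    rw [← fderiv_apply_const hB v, ← fderiv_apply_const (hB.clm_apply (differentiableAt_const v)),
      h1, fderiv_sub ((hDv.clm_apply (differentiableAt_const w)).add (hΓv.clm_apply hTw))
        (hT1.clm_apply hΓvw),
      fderiv_add (hDv.clm_apply (differentiableAt_const w)) (hΓv.clm_apply hTw)]
    simp only [add_apply, sub_apply]
    rw [fderiv_apply_const hDv, fderiv_apply_const hT2, fderiv_apply_field hΓv hTw,
      fderiv_apply_const hΓ, fderiv_apply_const hT1, fderiv_apply_field hT1 hΓvw,
      fderiv_apply_const hΓv, fderiv_apply_const hΓ]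
  have hsymm : fderiv ℝ (fderiv ℝ T) y u v = fderiv ℝ (fderiv ℝ T) y v u :=
    (hT.isSymmSndFDerivAt (by simp)).eq u v
  simp only [covBil_apply, key, covEnd_apply, curvEnd_apply, map_add, map_sub, hs v u, hsymm]
  abel

theorem curvEnd_bianchi (hΓ : DifferentiableAt ℝ Γ y)
    (hs : ∀ᶠ z in 𝓝 y, ∀ u v, Γ z u v = Γ z v u) (u v w : E) :
    curvEnd Γ y u v w + curvEnd Γ y v w u + curvEnd Γ y w u v = 0 := by
  have hs' := hs.self_of_nhds
  have key : ∀ u v w, fderiv ℝ Γ y u v w = fderiv ℝ Γ y u w v := by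
    intro u v w
    rw [← fderiv_apply_const hΓ v, ← fderiv_apply_const hΓ w,
      ← fderiv_apply_const (hΓ.clm_apply (differentiableAt_const v)),
      ← fderiv_apply_const (hΓ.clm_apply (differentiableAt_const w))]
    have : (fun z => Γ z v w) =ᶠ[𝓝 y] fun z => Γ z w v := hs.mono fun z hz => hz v w
    rw [this.fderiv_eq]
  simp only [curvEnd_apply, key u w v, key v u w, key w v u, hs' u w, hs' v u, hs' w v]
  abel

/-! ### Metric connections -/

section Metric

variable {G : E → E →L[ℝ] E →L[ℝ] ℝ}

theorem fderiv_metric_apply (hG : DifferentiableAt ℝ G y)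
    (hm : ∀ u v w, fderiv ℝ G y u v w = G y (Γ y u v) w + G y v (Γ y u w)) {X Y : E → E}
    (hX : DifferentiableAt ℝ X y) (hY : DifferentiableAt ℝ Y y) (u : E) :
    fderiv ℝ (fun z => G z (X z) (Y z)) y u =
      G y (covVec Γ X y u) (Y y) + G y (X y) (covVec Γ Y y u) := by
  rw [fderiv_apply_field (hG.clm_apply hX) hY, fderiv_apply_field hG hX, add_apply, hm]
  simp only [covVec_apply, map_add, add_apply]
  ring

/-- A metric connection preserves the bundle of skew endomorphisms. This is applied to `φ` and again
to `z ↦ B z u`. -/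
theorem covEnd_skew (hG : DifferentiableAt ℝ G y)
    (hm : ∀ u v w, fderiv ℝ G y u v w = G y (Γ y u v) w + G y v (Γ y u w))
    {T : E → E →L[ℝ] E} (hT : DifferentiableAt ℝ T y)
    (hs : ∀ᶠ z in 𝓝 y, ∀ u v, G z (T z u) v = -G z u (T z v)) (x u v : E) :
    G y (covEnd Γ T y x u) v = -G y u (covEnd Γ T y x v) := by
  have hs' := hs.self_of_nhds
  have h0 : (fun z => G z (T z u) v) =ᶠ[𝓝 y] fun z => -G z u (T z v) := hs.mono fun z hz => hz u v
  have h1 := DFunLike.congr_fun (h0.fderiv_eq (𝕜 := ℝ)) x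
  have h4 : fderiv ℝ (fun z => -G z u (T z v)) y x = -fderiv ℝ (fun z => G z u (T z v)) y x := by
    rw [fderiv_fun_neg]; rfl
  rw [h4,
    fderiv_metric_apply hG hm (hT.clm_apply (differentiableAt_const u)) (differentiableAt_const v),
    fderiv_metric_apply hG hm (differentiableAt_const u) (hT.clm_apply (differentiableAt_const v)),
    covVec_end_const hT, covVec_end_const hT, covVec_const, covVec_const] at h1
  simp only [map_add, add_apply] at h1
  have h2 := hs' (Γ y x u) v
  have h3 := hs' u (Γ y x v)
  linarith

/-- Differentiate the function `g(v, w)` of two constant fields twice. Its Hessian is symmetric and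
the products of two first derivatives cancel, leaving curvature acting as a derivation on `g`. -/
theorem curvEnd_skew (hG : ContDiffAt ℝ 2 G y) (hΓ : DifferentiableAt ℝ Γ y)
    (hm : ∀ᶠ z in 𝓝 y, ∀ u v w, fderiv ℝ G z u v w = G z (Γ z u v) w + G z v (Γ z u w))
    (x u v w : E) : G y (curvEnd Γ y x u v) w = -G y v (curvEnd Γ y x u w) := by
  have hm' := hm.self_of_nhds
  have hG1 : DifferentiableAt ℝ G y := hG.differentiableAt (by simp)
  have hG1' : ∀ᶠ z in 𝓝 y, DifferentiableAt ℝ G z :=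
    (hG.eventually (by simp)).mono fun z hz => hz.differentiableAt (by simp)
  let f : E → ℝ := fun z => G z v w
  have hf : ContDiffAt ℝ 2 f y := (hG.clm_apply contDiffAt_const).clm_apply contDiffAt_const
  have hf2 : DifferentiableAt ℝ (fderiv ℝ f) y :=
    (hf.fderiv_right (m := 1) (by norm_num)).differentiableAt (by simp)
  have key : ∀ x u, fderiv ℝ (fderiv ℝ f) y x u =
      G y (fderiv ℝ Γ y x u v + Γ y x (Γ y u v)) w + G y (Γ y u v) (Γ y x w)
        + (G y (Γ y x v) (Γ y u w) + G y v (fderiv ℝ Γ y x u w + Γ y x (Γ y u w))) := by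
    intro x u
    have hΓu : DifferentiableAt ℝ (fun z => Γ z u) y := hΓ.clm_apply (differentiableAt_const u)
    have hΓuv : ∀ v, DifferentiableAt ℝ (fun z => Γ z u v) y := fun v =>
      hΓu.clm_apply (differentiableAt_const v)
    have h0 : (fun z => fderiv ℝ f z u) =ᶠ[𝓝 y]
        (fun z => G z (Γ z u v) w) + fun z => G z v (Γ z u w) := by
      filter_upwards [hm, hG1'] with z hz hGz
      rw [fderiv_apply_const (hGz.clm_apply (differentiableAt_const v)), fderiv_apply_const hGz,
        hz]
      rfl
    rw [← fderiv_apply_const hf2, h0.fderiv_eq, fderiv_add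
      ((hG1.clm_apply (hΓuv v)).clm_apply (differentiableAt_const w))
      ((hG1.clm_apply (differentiableAt_const v)).clm_apply (hΓuv w)), add_apply,
      fderiv_metric_apply hG1 hm' (hΓuv v) (differentiableAt_const w),
      fderiv_metric_apply hG1 hm' (differentiableAt_const v) (hΓuv w),
      covVec_const, covVec_const, covVec_apply, covVec_apply, fderiv_apply_const hΓu,
      fderiv_apply_const hΓ, fderiv_apply_const hΓu, fderiv_apply_const hΓ]
  have hsymm : fderiv ℝ (fderiv ℝ f) y x u = fderiv ℝ (fderiv ℝ f) y u x :=
    (hf.isSymmSndFDerivAt (by simp)).eq x u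
  have h1 := key x u
  have h2 := key u x
  rw [hsymm] at h1
  rw [h1] at h2
  simp only [curvEnd_apply, map_add, map_sub, add_apply, sub_apply] at h2 ⊢
  linarith

end Metric

end Connection

/-! ### The Levi-Civita connection in coordinates -/

section LeviCivita

open Filter Topology

variable {E : Type*} [NormedAddCommGroup E] [NormedSpace ℝ E] [FiniteDimensional ℝ E]

set_option maxSynthPendingDepth 3 in
/-- The Christoffel symbols of a metric as a field of bilinear maps. -/
def christoffelCLM (G : E → E →L[ℝ] E →L[ℝ] ℝ) (y : E) : E →L[ℝ] E →L[ℝ] E :=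
  ContinuousLinearMap.compL ℝ E (E →L[ℝ] ℝ) E (G y).inverse ∘L
    ((1 / 2 : ℝ) • (fderiv ℝ G y + (fderiv ℝ G y).flip
      - ((ContinuousLinearMap.flipₗᵢ ℝ E E ℝ).toContinuousLinearEquiv :
          (E →L[ℝ] E →L[ℝ] ℝ) →L[ℝ] E →L[ℝ] E →L[ℝ] ℝ) ∘L (fderiv ℝ G y).flip))

variable {G : E → E →L[ℝ] E →L[ℝ] ℝ} {U : Set E} {y : E}

omit [FiniteDimensional ℝ E] in
theorem christoffelCLM_apply (y u v : E) : christoffelCLM G y u v = christoffel G y u v := rfl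

/-- A smooth Riemannian metric on an open set of a vector space. -/
structure IsLocalMetric (U : Set E) (G : E → E →L[ℝ] E →L[ℝ] ℝ) : Prop where
  isOpen : IsOpen U
  contDiffOn : ContDiffOn ℝ ∞ G U
  symm : ∀ y ∈ U, ∀ u v, G y u v = G y v u
  pos : ∀ y ∈ U, ∀ v, v ≠ 0 → 0 < G y v v

namespace IsLocalMetric

variable (h : IsLocalMetric U G)
include h

omit [FiniteDimensional ℝ E] in
theorem contDiffAt (hy : y ∈ U) : ContDiffAt ℝ ∞ G y :=
  h.contDiffOn.contDiffAt (h.isOpen.mem_nhds hy)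

omit [FiniteDimensional ℝ E] in
theorem differentiableAt (hy : y ∈ U) : DifferentiableAt ℝ G y :=
  (h.contDiffAt hy).differentiableAt (by simp)

omit [FiniteDimensional ℝ E] in
theorem eventually_mem (hy : y ∈ U) : ∀ᶠ z in 𝓝 y, z ∈ U := h.isOpen.mem_nhds hy

omit [FiniteDimensional ℝ E] in
theorem fderiv_symm (hy : y ∈ U) (u v w : E) : fderiv ℝ G y u v w = fderiv ℝ G y u w v := by
  have hG := h.differentiableAt hy
  rw [← fderiv_apply_const hG v, ← fderiv_apply_const hG w,
    ← fderiv_apply_const (hG.clm_apply (differentiableAt_const v)),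
    ← fderiv_apply_const (hG.clm_apply (differentiableAt_const w))]
  have : (fun z => G z v w) =ᶠ[𝓝 y] fun z => G z w v :=
    (h.eventually_mem hy).mono fun z hz => h.symm z hz v w
  rw [this.fderiv_eq]

theorem metric_christoffel (hy : y ∈ U) (u v w : E) :
    G y (christoffelCLM G y u v) w =
      1 / 2 * (fderiv ℝ G y u v w + fderiv ℝ G y v u w - fderiv ℝ G y w u v) := by
  rw [christoffelCLM_apply, christoffel, metric_inverse_apply (h.pos y hy)]
  rfl

theorem christoffel_symm (hy : y ∈ U) (u v : E) :
    christoffelCLM G y u v = christoffelCLM G y v u := by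
  refine eq_of_forall_metric_eq (h.pos y hy) fun w => ?_
  rw [h.metric_christoffel hy, h.metric_christoffel hy, h.fderiv_symm hy w]
  ring

theorem metric_compatible (hy : y ∈ U) (u v w : E) :
    fderiv ℝ G y u v w =
      G y (christoffelCLM G y u v) w + G y v (christoffelCLM G y u w) := by
  rw [h.symm y hy v, h.metric_christoffel hy, h.metric_christoffel hy, h.fderiv_symm hy u w v]
  ring

theorem contDiffOn_inverse : ContDiffOn ℝ ∞ (fun z => (G z).inverse) U := by
  intro y hy
  obtain ⟨e, he⟩ := isInvertible_of_posDef (h.pos y hy)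
  have h1 := contDiffAt_map_inverse (n := ∞) e
  rw [he] at h1
  exact (h1.comp y (h.contDiffAt hy)).contDiffWithinAt

set_option maxSynthPendingDepth 3 in
theorem contDiffOn_christoffel : ContDiffOn ℝ ∞ (christoffelCLM G) U := by
  have hD : ContDiffOn ℝ ∞ (fderiv ℝ G) U := h.contDiffOn.fderiv_of_isOpen h.isOpen (by simp)
  have hD3 : ∀ u v w, ContDiffOn ℝ ∞ (fun z => fderiv ℝ G z u v w) U := fun u v w =>
    ((hD.clm_apply contDiffOn_const).clm_apply contDiffOn_const).clm_apply contDiffOn_const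
  rw [contDiffOn_clm_apply]
  intro u
  rw [contDiffOn_clm_apply]
  intro v
  refine h.contDiffOn_inverse.clm_apply (contDiffOn_clm_apply.mpr fun w => ?_)
  exact contDiffOn_const.mul (((hD3 u v w).add (hD3 v u w)).sub (hD3 w u v))

theorem differentiableAt_christoffel (hy : y ∈ U) : DifferentiableAt ℝ (christoffelCLM G) y :=
  (h.contDiffOn_christoffel.contDiffAt (h.isOpen.mem_nhds hy)).differentiableAt (by simp)

/-- Constant fields commute, so the bracket term drops out. -/
theorem localCurvature_eq (hy : y ∈ U) (u v w : E) :
    localCurvature G y u v w = curvEnd (christoffelCLM G) y u v w := by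
  have hΓ := h.differentiableAt_christoffel hy
  have h1 : ∀ v w : E, nabla G (fun _ => v) (fun _ => w) = fun z => christoffelCLM G z v w := by
    intro v w
    ext z
    simp [nabla, christoffelCLM_apply]
  have h2 : VectorField.lieBracket ℝ (fun _ : E => u) (fun _ => v) = fun _ => 0 := by
    ext z
    simp [VectorField.lieBracket]
  have h3 : ∀ u v w : E, nabla G (fun _ => u) (fun z => christoffelCLM G z v w) y =
      fderiv ℝ (christoffelCLM G) y u v w
        + christoffelCLM G y u (christoffelCLM G y v w) := by
    intro u v w
    rw [nabla, fderiv_apply_const (hΓ.clm_apply (differentiableAt_const v)),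
      fderiv_apply_const hΓ]
    rfl
  rw [localCurvature, curvatureField, h2]
  simp only [h1, Pi.sub_apply, h3, map_zero, zero_apply, sub_zero, curvEnd_apply]
  abel

theorem curvEnd_skew (hy : y ∈ U) (x u v w : E) :
    G y (curvEnd (christoffelCLM G) y x u v) w = -G y v (curvEnd (christoffelCLM G) y x u w) :=
  CK.curvEnd_skew ((h.contDiffAt hy).of_le ENat.LEInfty.out)
    (h.differentiableAt_christoffel hy)
    ((h.eventually_mem hy).mono fun _ hz => h.metric_compatible hz) x u v w

theorem curvEnd_bianchi (hy : y ∈ U) (u v w : E) :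
    curvEnd (christoffelCLM G) y u v w + curvEnd (christoffelCLM G) y v w u
      + curvEnd (christoffelCLM G) y w u v = 0 :=
  CK.curvEnd_bianchi (h.differentiableAt_christoffel hy)
    ((h.eventually_mem hy).mono fun _ hz => h.christoffel_symm hz) u v w

end IsLocalMetric

end LeviCivita

/-! ### Almost cokähler structures in coordinates -/

section LocalCokahler

open Filter Topology

variable {E : Type*} [NormedAddCommGroup E] [NormedSpace ℝ E]

/-- An almost cokähler structure on an open set of a vector space; the forms are
`α = G(ξ, ·)` and `ω = G(φ ·, ·)`. -/
structure IsLocalCokahler (U : Set E) (G : E → E →L[ℝ] E →L[ℝ] ℝ) (ξ : E → E)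
    (φ : E → E →L[ℝ] E) : Prop extends IsLocalMetric U G where
  contDiffOn_xi : ContDiffOn ℝ ∞ ξ U
  contDiffOn_phi : ContDiffOn ℝ ∞ φ U
  metric_xi_xi : ∀ y ∈ U, G y (ξ y) (ξ y) = 1
  skew : ∀ y ∈ U, ∀ u v, G y (φ y u) v = -G y u (φ y v)
  phi_phi : ∀ y ∈ U, ∀ v, φ y (φ y v) = -v + G y v (ξ y) • ξ y
  closed_alpha : ∀ y ∈ U, ∀ u v,
    fderiv ℝ (fun z => G z (ξ z) v) y u = fderiv ℝ (fun z => G z (ξ z) u) y v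
  closed_omega : ∀ y ∈ U, ∀ u v w, fderiv ℝ (fun z => G z (φ z v) w) y u
    + fderiv ℝ (fun z => G z (φ z w) u) y v + fderiv ℝ (fun z => G z (φ z u) v) y w = 0

namespace IsLocalCokahler

variable {U : Set E} {G : E → E →L[ℝ] E →L[ℝ] ℝ} {ξ : E → E}
  {φ : E → E →L[ℝ] E} {y : E}

local notation "Γ₀" => christoffelCLM G
local notation "A" => covVec (christoffelCLM G) ξ
local notation "B" => covEnd (christoffelCLM G) φ

variable (h : IsLocalCokahler U G ξ φ)
include h

theorem contDiffAt_xi (hy : y ∈ U) : ContDiffAt ℝ ∞ ξ y :=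
  h.contDiffOn_xi.contDiffAt (h.isOpen.mem_nhds hy)

theorem contDiffAt_phi (hy : y ∈ U) : ContDiffAt ℝ ∞ φ y :=
  h.contDiffOn_phi.contDiffAt (h.isOpen.mem_nhds hy)

theorem differentiableAt_xi (hy : y ∈ U) : DifferentiableAt ℝ ξ y :=
  (h.contDiffAt_xi hy).differentiableAt (by simp)

theorem differentiableAt_phi (hy : y ∈ U) : DifferentiableAt ℝ φ y :=
  (h.contDiffAt_phi hy).differentiableAt (by simp)

/-- `|φ ξ|² = -g(ξ, φ² ξ) = 0`. -/
theorem phi_xi (hy : y ∈ U) : φ y (ξ y) = 0 := by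
  by_contra h0
  have h1 := h.pos y hy _ h0
  rw [h.skew y hy, h.phi_phi y hy, h.metric_xi_xi y hy] at h1
  simp at h1

theorem covEnd_xi (hy : y ∈ U) (x : E) : B y x (ξ y) = -φ y (A y x) := by
  have h0 : (fun z => φ z (ξ z)) =ᶠ[𝓝 y] fun _ => (0 : E) :=
    (h.eventually_mem hy).mono fun z hz => h.phi_xi hz
  have h1 := DFunLike.congr_fun (covVec_congr (Γ := Γ₀) h0) x
  rw [covVec_end (h.differentiableAt_phi hy) (h.differentiableAt_xi hy), covVec_const,
    map_zero] at h1
  exact eq_neg_of_add_eq_zero_left h1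

variable [FiniteDimensional ℝ E]

theorem differentiableAt_covVec (hy : y ∈ U) : DifferentiableAt ℝ A y := by
  have h1 : DifferentiableAt ℝ (fderiv ℝ ξ) y :=
    ((h.contDiffAt_xi hy).fderiv_right (m := 1)
      (one_add_one_eq_two.trans_le ENat.LEInfty.out)).differentiableAt (by simp)
  have h2 : DifferentiableAt ℝ (fun z => (Γ₀ z).flip) y :=
    (ContinuousLinearMap.flipₗᵢ ℝ E E E).toContinuousLinearEquiv.differentiableAt.comp y
      (h.differentiableAt_christoffel hy)
  exact h1.add (h2.clm_apply (h.differentiableAt_xi hy))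

theorem differentiableAt_covEnd (hy : y ∈ U) : DifferentiableAt ℝ B y := by
  have h0 : DifferentiableAt ℝ (fderiv ℝ φ) y :=
    ((h.contDiffAt_phi hy).fderiv_right (m := 1)
      (one_add_one_eq_two.trans_le ENat.LEInfty.out)).differentiableAt (by simp)
  have h1 : DifferentiableAt ℝ (fun z => (ContinuousLinearMap.compL ℝ E E E).flip (φ z)) y :=
    ((ContinuousLinearMap.compL ℝ E E E).flip).differentiableAt.comp y (h.differentiableAt_phi hy)
  have h2 : DifferentiableAt ℝ (fun z => (ContinuousLinearMap.compL ℝ E E E) (φ z)) y :=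
    ((ContinuousLinearMap.compL ℝ E E E)).differentiableAt.comp y (h.differentiableAt_phi hy)
  have hΓ := h.differentiableAt_christoffel hy
  exact (h0.add (h1.clm_comp hΓ)).sub (h2.clm_comp hΓ)

/-- This is `dα = 0`: with a torsion-free connection, the Christoffel terms cancel in the
antisymmetrization of `∇α`. -/
theorem metric_covVec_symm (hy : y ∈ U) (u v : E) : G y (A y u) v = G y u (A y v) := by
  have h1 := h.closed_alpha y hy u v
  have hm := h.metric_compatible hy
  have hG := h.differentiableAt hy
  rw [fderiv_metric_apply hG hm (h.differentiableAt_xi hy) (differentiableAt_const v),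
    fderiv_metric_apply hG hm (h.differentiableAt_xi hy) (differentiableAt_const u),
    covVec_const, covVec_const, h.christoffel_symm hy v u] at h1
  rw [h.symm y hy u]
  linarith

theorem metric_covVec_xi (hy : y ∈ U) (u : E) : G y (A y u) (ξ y) = 0 := by
  have h0 : (fun z => G z (ξ z) (ξ z)) =ᶠ[𝓝 y] fun _ => (1 : ℝ) :=
    (h.eventually_mem hy).mono fun z hz => h.metric_xi_xi z hz
  have h1 := DFunLike.congr_fun (h0.fderiv_eq (𝕜 := ℝ)) u
  rw [fderiv_metric_apply (h.differentiableAt hy) (h.metric_compatible hy)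
    (h.differentiableAt_xi hy) (h.differentiableAt_xi hy), fderiv_fun_const,
    h.symm y hy (ξ y)] at h1
  simp only [Pi.zero_apply, zero_apply] at h1
  linarith

theorem covVec_xi (hy : y ∈ U) : A y (ξ y) = 0 := by
  refine eq_of_forall_metric_eq (h.pos y hy) fun w => ?_
  rw [h.metric_covVec_symm hy, h.symm y hy, h.metric_covVec_xi hy]
  simp

theorem metric_covEnd_skew (hy : y ∈ U) (x u v : E) : G y (B y x u) v = -G y u (B y x v) :=
  covEnd_skew (h.differentiableAt hy) (h.metric_compatible hy) (h.differentiableAt_phi hy)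
    ((h.eventually_mem hy).mono fun z hz => h.skew z hz) x u v

/-- The covariant derivative of `φ² = -1 + ξ ⊗ α`. -/
theorem covEnd_phi_add (hy : y ∈ U) (x v : E) : B y x (φ y v) + φ y (B y x v) =
    G y v (ξ y) • A y x + G y v (A y x) • ξ y := by
  have hφ := h.differentiableAt_phi hy
  have hξ := h.differentiableAt_xi hy
  have hG := h.differentiableAt hy
  have hc : DifferentiableAt ℝ (fun z => G z v (ξ z)) y :=
    (hG.clm_apply (differentiableAt_const v)).clm_apply hξ
  have h0 : (fun z => φ z (φ z v)) =ᶠ[𝓝 y] fun z => -v + G z v (ξ z) • ξ z :=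
    (h.eventually_mem hy).mono fun z hz => h.phi_phi z hz v
  have h1 := DFunLike.congr_fun (covVec_congr (Γ := Γ₀) h0) x
  have h2 : covVec Γ₀ (fun z => -v + G z v (ξ z) • ξ z) y x =
      -Γ₀ y x v + (G y (Γ₀ y x v) (ξ y) + G y v (A y x)) • ξ y + G y v (ξ y) • A y x := by
    rw [covVec_apply, fderiv_const_add, fderiv_fun_smul hc hξ, add_apply,
      ContinuousLinearMap.smulRight_apply, smul_apply,
      fderiv_metric_apply hG (h.metric_compatible hy) (differentiableAt_const v) hξ,
      covVec_const, covVec_apply]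
    simp only [map_add, map_neg, map_smul]
    module
  rw [h2, covVec_end hφ (hφ.clm_apply (differentiableAt_const v)), covVec_end_const hφ, map_add,
    h.phi_phi y hy] at h1
  have h3 : B y x (φ y v) + φ y (B y x v) = (-Γ₀ y x v +
      (G y (Γ₀ y x v) (ξ y) + G y v (A y x)) • ξ y + G y v (ξ y) • A y x)
      - (-Γ₀ y x v + G y (Γ₀ y x v) (ξ y) • ξ y) := by
    rw [← h1]; abel
  rw [h3]
  module

/-- This is `dω = 0`: the six Christoffel terms cancel in pairs by symmetry of `Γ`. -/
theorem covEnd_cyclic (hy : y ∈ U) (u v w : E) :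
    G y (B y u v) w + G y (B y v w) u + G y (B y w u) v = 0 := by
  have h1 := h.closed_omega y hy u v w
  have hm := h.metric_compatible hy
  have hG := h.differentiableAt hy
  have hφ := h.differentiableAt_phi hy
  have hΓ := h.christoffel_symm hy
  have key : ∀ u v w, fderiv ℝ (fun z => G z (φ z v) w) y u =
      G y (B y u v) w - G y (Γ₀ y u v) (φ y w) + G y (φ y v) (Γ₀ y u w) := by
    intro u v w
    rw [fderiv_metric_apply hG hm (hφ.clm_apply (differentiableAt_const v))
      (differentiableAt_const w), covVec_end_const hφ, covVec_const, map_add, add_apply,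
      h.skew y hy (Γ₀ y u v)]
    ring
  rw [key, key, key, hΓ v u, hΓ w u, hΓ w v, h.symm y hy (φ y v), h.symm y hy (φ y w),
    h.symm y hy (φ y u)] at h1
  linarith

/-- The cyclic identity with `ξ` in the last slot, where `covEnd_xi` turns derivatives of `φ` into
`φ ∘ A`. -/
theorem phi_covVec_add (hy : y ∈ U) (u : E) :
    φ y (A y u) + A y (φ y u) + B y (ξ y) u = 0 := by
  refine eq_of_forall_metric_eq (h.pos y hy) fun v => ?_
  have h1 := h.covEnd_cyclic hy u v (ξ y)
  have h2 := h.metric_covEnd_skew hy u v (ξ y)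
  have h3 := h.symm y hy v (φ y (A y u))
  have h4 := h.skew y hy (A y v) u
  have h5 := h.metric_covVec_symm hy v (φ y u)
  have h6 := h.symm y hy v (A y (φ y u))
  rw [h.covEnd_xi hy] at h1 h2
  simp only [map_neg, neg_apply, map_add, add_apply, map_zero, zero_apply] at *
  linarith

/-- Trace `covEnd_phi_add`: the left side gives `2 tr(φ B_u)`, the right side `2 g(A u, ξ) = 0`. -/
theorem traceCLM_phi_covEnd (hy : y ∈ U) (u : E) : traceCLM E (φ y ∘L B y u) = 0 := by
  have h1 : B y u ∘L φ y + φ y ∘L B y u = ((G y).flip (ξ y)).smulRight (A y u)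
      + ((G y).flip (A y u)).smulRight (ξ y) := by
    ext v
    exact h.covEnd_phi_add hy u v
  have h2 := congrArg (traceCLM E) h1
  rw [map_add, map_add, traceCLM_comp_comm, traceCLM_smulRight, traceCLM_smulRight,
    ContinuousLinearMap.flip_apply, ContinuousLinearMap.flip_apply, h.symm y hy (ξ y),
    h.metric_covVec_xi hy] at h2
  linarith

/-- The Reeb field is divergence free. -/
theorem traceCLM_covVec (hy : y ∈ U) : traceCLM E (A y) = 0 := by
  -- Compose `phi_covVec_add` with `φ`. The first two terms each have trace `-tr A`, and the third
  -- is traceless.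
  have h1 : φ y ∘L (φ y ∘L A y) + φ y ∘L (A y ∘L φ y) + φ y ∘L B y (ξ y) = 0 := by
    ext v
    have := congrArg (φ y) (h.phi_covVec_add hy v)
    simpa using this
  have h2 := congrArg (traceCLM E) h1
  have h3 : φ y ∘L (φ y ∘L A y) = -A y := by
    ext v
    simp [h.phi_phi y hy, h.metric_covVec_xi hy]
  have h4 : traceCLM E (φ y ∘L (A y ∘L φ y)) = traceCLM E (φ y ∘L (φ y ∘L A y)) := by
    rw [traceCLM_comp_comm, ContinuousLinearMap.comp_assoc, traceCLM_comp_comm]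
    rfl
  rw [map_add, map_add, h4, h.traceCLM_phi_covEnd hy, h3, map_zero, map_neg] at h2
  linarith

/-- `A` is symmetric and `φ` skew, so the adjoint of `φ A` is `-A φ`. -/
theorem traceCLM_phi_covVec (hy : y ∈ U) : traceCLM E (φ y ∘L A y) = 0 := by
  have h1 : traceCLM E (φ y ∘L A y) = traceCLM E (-(A y ∘L φ y)) := by
    refine traceCLM_eq_of_adjoint (h.pos y hy) fun u v => ?_
    simp [h.skew y hy, h.metric_covVec_symm hy]
  rw [map_neg, traceCLM_comp_comm (A y)] at h1
  linarith

/-- The fundamental form is divergence free. -/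
theorem traceCLM_covEnd_flip (hy : y ∈ U) (w : E) : traceCLM E ((B y).flip w) = 0 := by
  have h1 : ∀ w, traceCLM E (φ y ∘L (B y).flip w) = 0 := by
    intro w
    -- By the cyclic identity the two sides are adjoint. As `tr(φ B_w) = 0`, the trace of `(B
    -- y).flip w ∘ φ` equals its own negative.
    have h2 : traceCLM E ((B y).flip w ∘L φ y) =
        traceCLM E (φ y ∘L B y w - φ y ∘L (B y).flip w) := by
      refine traceCLM_eq_of_adjoint (h.pos y hy) fun x u => ?_
      have h3 := h.covEnd_cyclic hy u (φ y x) w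
      have h4 := h.metric_covEnd_skew hy u (φ y x) w
      have h5 := h.skew y hy x (B y u w)
      have h6 := h.skew y hy x (B y w u)
      have h7 := h.symm y hy (B y w u) (φ y x)
      simp only [ContinuousLinearMap.comp_apply, ContinuousLinearMap.flip_apply, sub_apply,
        map_sub]
      linarith
    rw [map_sub, h.traceCLM_phi_covEnd hy, traceCLM_comp_comm] at h2
    linarith
  -- It suffices to treat `w` in the image of `φ` and `w = ξ`, since `w = α(w) ξ - φ² w`.
  have h2 : ∀ w, traceCLM E ((B y).flip (φ y w)) = 0 := by
    intro w
    have h3 : (B y).flip (φ y w) + φ y ∘L (B y).flip w =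
        G y w (ξ y) • A y + ((G y w) ∘L A y).smulRight (ξ y) := by
      ext x
      exact h.covEnd_phi_add hy x w
    have h4 := congrArg (traceCLM E) h3
    rw [map_add, map_add, h1, map_smul, h.traceCLM_covVec hy, traceCLM_smulRight,
      ContinuousLinearMap.comp_apply, h.covVec_xi hy] at h4
    simpa using h4
  have h3 : traceCLM E ((B y).flip (ξ y)) = 0 := by
    have h4 : (B y).flip (ξ y) = -(φ y ∘L A y) := by
      ext x
      exact h.covEnd_xi hy x
    rw [h4, map_neg, h.traceCLM_phi_covVec hy, neg_zero]
  have h4 : (B y).flip w = G y w (ξ y) • (B y).flip (ξ y) - (B y).flip (φ y (φ y w)) := by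
    rw [h.phi_phi y hy, map_add, map_neg, map_smul]
    abel
  rw [h4, map_sub, map_smul, h3, h2, smul_zero, sub_zero]

end IsLocalCokahler

end LocalCokahler

/-! ### Second covariant derivatives, the Weitzenböck formula and the local inequality -/

section LocalBochner

open Filter Topology

variable {E : Type*} [NormedAddCommGroup E] [NormedSpace ℝ E] [FiniteDimensional ℝ E]

namespace IsLocalCokahler

variable {U : Set E} {G : E → E →L[ℝ] E →L[ℝ] ℝ} {ξ : E → E} {φ : E → E →L[ℝ] E} {y : E}

local notation "Γ₀" => christoffelCLM G
local notation "A" => covVec (christoffelCLM G) ξ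
local notation "B" => covEnd (christoffelCLM G) φ
local notation "C" => covBil (christoffelCLM G) (covEnd (christoffelCLM G) φ) y
local notation "R" => curvEnd (christoffelCLM G) y

variable (h : IsLocalCokahler U G ξ φ)
include h

theorem covEnd_covVec_xi (hy : y ∈ U) (u : E) : covEnd Γ₀ A y u (ξ y) = -A y (A y u) := by
  have h0 : (fun z => A z (ξ z)) =ᶠ[𝓝 y] fun _ => (0 : E) :=
    (h.eventually_mem hy).mono fun z hz => h.covVec_xi hz
  have h1 := DFunLike.congr_fun (covVec_congr (Γ := Γ₀) h0) u
  rw [covVec_end (h.differentiableAt_covVec hy) (h.differentiableAt_xi hy), covVec_const,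
    map_zero] at h1
  exact eq_neg_of_add_eq_zero_left h1

theorem traceCLM_covEnd_covVec (hy : y ∈ U) (u : E) : traceCLM E (covEnd Γ₀ A y u) = 0 := by
  have h0 : (fun z => traceCLM E (A z)) =ᶠ[𝓝 y] fun _ => (0 : ℝ) :=
    (h.eventually_mem hy).mono fun z hz => h.traceCLM_covVec hz
  rw [← fderiv_traceCLM (h.differentiableAt_covVec hy), h0.fderiv_eq]
  simp

/-- An identity that is linear in `B` and holds throughout `U` passes to `∇B`: after
differentiation, the Christoffel terms on the frozen vectors are again instances of the identity.
The cyclic identity and the divergence are handled likewise. -/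
theorem metric_covBil_skew (hy : y ∈ U) (x u v w : E) :
    G y (C x u v) w = -G y v (C x u w) := by
  have hB := h.differentiableAt_covEnd hy
  have h1 := covEnd_skew (h.differentiableAt hy) (h.metric_compatible hy)
    (hB.clm_apply (differentiableAt_const u))
    ((h.eventually_mem hy).mono fun z hz => h.metric_covEnd_skew hz u) x v w
  rw [covEnd_bil_apply hB] at h1
  have h2 := h.metric_covEnd_skew hy (Γ₀ y x u) v w
  simp only [add_apply, map_add] at h1
  linarith

theorem covBil_cyclic (hy : y ∈ U) (x u v w : E) :
    G y (C x u v) w + G y (C x v w) u + G y (C x w u) v = 0 := by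
  have hB := h.differentiableAt_covEnd hy
  have hG := h.differentiableAt hy
  have hm := h.metric_compatible hy
  have hd : ∀ u v, DifferentiableAt ℝ (fun z => B z u v) y := fun u v =>
    (hB.clm_apply (differentiableAt_const u)).clm_apply (differentiableAt_const v)
  have hd' : ∀ u v w, DifferentiableAt ℝ (fun z => G z (B z u v) w) y := fun u v w =>
    (hG.clm_apply (hd u v)).clm_apply (differentiableAt_const w)
  have h0 : ((fun z => G z (B z u v) w) + fun z => G z (B z v w) u) +
      (fun z => G z (B z w u) v) =ᶠ[𝓝 y] fun _ => (0 : ℝ) :=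
    (h.eventually_mem hy).mono fun z hz => h.covEnd_cyclic hz u v w
  have h1 := DFunLike.congr_fun (h0.fderiv_eq (𝕜 := ℝ)) x
  have key : ∀ u v w, fderiv ℝ (fun z => G z (B z u v) w) y x =
      G y (C x u v) w + G y (B y (Γ₀ y x u) v) w + G y (B y u (Γ₀ y x v)) w
        + G y (B y u v) (Γ₀ y x w) := by
    intro u v w
    rw [fderiv_metric_apply hG hm (hd u v) (differentiableAt_const w), covVec_bil_const hB,
      covVec_const]
    simp only [map_add, add_apply]
  rw [fderiv_add ((hd' u v w).add (hd' v w u)) (hd' w u v), fderiv_add (hd' u v w) (hd' v w u),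
    add_apply, add_apply, key, key, key, fderiv_fun_const] at h1
  simp only [Pi.zero_apply, zero_apply] at h1
  have h2 := h.covEnd_cyclic hy (Γ₀ y x u) v w
  have h3 := h.covEnd_cyclic hy u (Γ₀ y x v) w
  have h4 := h.covEnd_cyclic hy u v (Γ₀ y x w)
  linarith

theorem traceCLM_covBil_flip (hy : y ∈ U) (x w : E) : traceCLM E ((C x).flip w) = 0 := by
  have hB := h.differentiableAt_covEnd hy
  have hf : DifferentiableAt ℝ (fun z => (B z).flip w) y :=
    ((ContinuousLinearMap.flipₗᵢ ℝ E E E).toContinuousLinearEquiv.differentiableAt.comp y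
      hB).clm_apply (differentiableAt_const w)
  have h0 : (fun z => traceCLM E ((B z).flip w)) =ᶠ[𝓝 y] fun _ => (0 : ℝ) :=
    (h.eventually_mem hy).mono fun z hz => h.traceCLM_covEnd_flip hz w
  have h1 := fderiv_traceCLM (Γ := Γ₀) hf x
  rw [h0.fderiv_eq, covEnd_bil_flip hB, map_add, h.traceCLM_covEnd_flip hy] at h1
  simpa using h1.symm

/-- Differentiate `tr(φ B_u) = 0`; here `φ` is differentiated too, which produces the quadratic term
in `B`. -/
theorem traceCLM_phi_covBil (hy : y ∈ U) (x u : E) :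
    traceCLM E (φ y ∘L C x u) = -traceCLM E (B y x ∘L B y u) := by
  have hB := h.differentiableAt_covEnd hy
  have hφ := h.differentiableAt_phi hy
  have hu := hB.clm_apply (differentiableAt_const u)
  have h0 : (fun z => traceCLM E (φ z ∘L B z u)) =ᶠ[𝓝 y] fun _ => (0 : ℝ) :=
    (h.eventually_mem hy).mono fun z hz => h.traceCLM_phi_covEnd hz u
  have h1 := fderiv_traceCLM (Γ := Γ₀) (hφ.clm_comp hu) x
  rw [h0.fderiv_eq, covEnd_comp hφ hu, covEnd_bil_apply hB, ContinuousLinearMap.comp_add,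
    map_add, map_add, h.traceCLM_phi_covEnd hy] at h1
  simp only [fderiv_fun_const, Pi.zero_apply, zero_apply] at h1
  linarith

theorem covBil_sub (hy : y ∈ U) (u v w : E) :
    C u v w = C v u w + R u v (φ y w) - φ y (R u v w) := by
  have h1 := covBil_covEnd_sub ((h.contDiffAt_phi hy).of_le ENat.LEInfty.out)
    (h.differentiableAt_christoffel hy) (h.christoffel_symm hy) u v w
  rw [add_sub_assoc, ← h1]
  abel

section Frame

variable {ι : Type*} [Fintype ι] [DecidableEq ι] {e : ι → E}
  (he : ∀ i j, G y (e i) (e j) = if i = j then 1 else 0)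
  (hd : Fintype.card ι = Module.finrank ℝ E)
include he hd

/-- The Riccati identity `Ric(ξ, ξ) = -|∇ξ|²`. -/
theorem ricci_xi (hy : y ∈ U) :
    ∑ i, G y (R (e i) (ξ y) (ξ y)) (e i) = -∑ i, G y (A y (e i)) (A y (e i)) := by
  -- Ricci identity for `ξ`: `∇²_{u,ξ} ξ` is `-A² u` because `A ξ = 0`, and `u ↦ ∇²_{ξ,u} ξ` is
  -- traceless because `tr A = 0`.
  have h1 : ∀ u, R u (ξ y) (ξ y) = -A y (A y u) - covEnd Γ₀ A y (ξ y) u := by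
    intro u
    rw [← h.covEnd_covVec_xi hy]
    exact (covEnd_covVec_sub ((h.contDiffAt_xi hy).of_le ENat.LEInfty.out)
      (h.differentiableAt_christoffel hy) (h.christoffel_symm hy) u (ξ y)).symm
  have h2 := traceCLM_eq_sum he hd (covEnd Γ₀ A y (ξ y))
  rw [h.traceCLM_covEnd_covVec hy] at h2
  simp only [h1, map_sub, map_neg, sub_apply, neg_apply, Finset.sum_sub_distrib, ← h2,
    Finset.sum_neg_distrib, h.metric_covVec_symm hy (A y _), sub_zero]

theorem sum_phi_left (hy : y ∈ U) (F : E →ₗ[ℝ] E →ₗ[ℝ] ℝ) :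
    ∑ i, F (φ y (e i)) (e i) = -∑ i, F (e i) (φ y (e i)) := by
  have h1 : ∀ i, F (φ y (e i)) (e i) = ∑ j, G y (φ y (e i)) (e j) * F (e j) (e i) := by
    intro i
    conv_lhs => rw [sum_frame he hd (φ y (e i))]
    simp
  have h2 : ∀ i, F (e i) (φ y (e i)) = ∑ j, G y (φ y (e i)) (e j) * F (e i) (e j) := by
    intro i
    conv_lhs => rw [sum_frame he hd (φ y (e i))]
    simp
  simp only [h1, h2]
  rw [Finset.sum_comm, ← Finset.sum_neg_distrib]
  refine Finset.sum_congr rfl fun i _ => ?_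
  rw [← Finset.sum_neg_distrib]
  refine Finset.sum_congr rfl fun j _ => ?_
  rw [h.skew y hy, h.symm y hy]
  ring

/-- Closedness of `ω` expresses `∇²_{x,x} φ`, contracted with `φ`, by mixed derivatives. -/
theorem sum_covBil (hy : y ∈ U) (x : E) :
    ∑ j, G y (C x x (e j)) (φ y (e j)) = 2 * ∑ j, G y (C x (e j) x) (φ y (e j)) := by
  have h1 : ∀ j, G y (C x x (e j)) (φ y (e j)) =
      G y (C x (e j) x) (φ y (e j)) - G y (C x (φ y (e j)) x) (e j) := by
    intro j
    have h2 := h.covBil_cyclic hy x x (e j) (φ y (e j))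
    have h3 := h.metric_covBil_skew hy x (e j) (φ y (e j)) x
    have h4 := h.symm y hy (φ y (e j)) (C x (e j) x)
    linarith
  have h2 := h.sum_phi_left he hd hy
    (LinearMap.mk₂ ℝ (fun a b => G y (C x a x) b) (by simp) (by simp) (by simp) (by simp))
  simp only [LinearMap.mk₂_apply] at h2
  simp only [h1, Finset.sum_sub_distrib, h2]
  ring

/-- The Weitzenböck formula for the fundamental form. -/
theorem sum_metric_covEnd (hy : y ∈ U) {τ : ℝ}
    (hτ : ∀ u v, ∑ i, G y (R (e i) u v) (e i) = τ * G y u v) :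
    ∑ i, ∑ j, G y (B y (e i) (e j)) (B y (e i) (e j)) =
      2 * ∑ j, ∑ i, G y (R (e j) (e i) (φ y (e i))) (φ y (e j))
        - 2 * (τ * ((Fintype.card ι : ℝ) - 1)) := by
  -- This trades `|B_x|²` for a second derivative of `φ`, which `sum_covBil` then rewrites so that
  -- the two differentiation directions can be exchanged.
  have h1 : ∀ x, ∑ j, G y (B y x (e j)) (B y x (e j)) =
      -∑ j, G y (C x x (e j)) (φ y (e j)) := by
    intro x
    have h2 := h.traceCLM_phi_covBil hy x x
    rw [traceCLM_eq_sum he hd, traceCLM_eq_sum he hd] at h2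
    simp only [ContinuousLinearMap.comp_apply, h.skew y hy (C x x _),
      h.metric_covEnd_skew hy x (B y x _), Finset.sum_neg_distrib, neg_neg] at h2
    rw [h2]
  -- After the exchange, the leading term is a derivative of the divergence of `φ` and vanishes;
  -- only the curvature commutator is left.
  have h3 : ∀ j, ∑ i, G y (C (e i) (e j) (e i)) (φ y (e j)) =
      -(∑ i, G y (R (e j) (e i) (φ y (e i))) (φ y (e j)))
        - ∑ i, G y (φ y (R (e i) (e j) (e i))) (φ y (e j)) := by
    intro j
    have h4 : ∑ i, G y (C (e j) (e i) (e i)) (φ y (e j)) = 0 := by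
      have h5 := h.traceCLM_covBil_flip hy (e j) (φ y (e j))
      rw [traceCLM_eq_sum he hd] at h5
      simp only [h.metric_covBil_skew hy (e j) (e _) (e _), h.symm y hy (e _) (C _ _ _)]
      simp only [ContinuousLinearMap.flip_apply] at h5
      rw [Finset.sum_neg_distrib, h5, neg_zero]
    simp only [h.covBil_sub hy (e _) (e j), curvEnd_swap (e _) (e j) (φ y _), map_add, map_sub,
      add_apply, sub_apply, Finset.sum_add_distrib, Finset.sum_sub_distrib, h4, map_neg,
      neg_apply, Finset.sum_neg_distrib]
    ring
  -- Moving both copies of `φ` across makes this `Ric(e_j, φ² e_j)`. Summed over `j`, the trace of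
  -- `φ²` produces the factor `dim - 1`.
  have h6 : ∀ j, ∑ i, G y (φ y (R (e i) (e j) (e i))) (φ y (e j)) =
      -(τ * (1 - G y (e j) (ξ y) * G y (e j) (ξ y))) := by
    intro j
    have h7 : ∀ i, G y (φ y (R (e i) (e j) (e i))) (φ y (e j)) =
        G y (R (e i) (e j) (φ y (φ y (e j)))) (e i) := by
      intro i
      rw [h.skew y hy, h.curvEnd_skew hy, neg_neg, h.symm y hy]
    simp only [h7]
    rw [hτ, h.phi_phi y hy, map_add, map_neg, map_smul, he, if_pos rfl, smul_eq_mul]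
    ring
  have h8 : ∑ j, G y (e j) (ξ y) * G y (e j) (ξ y) = 1 := by
    rw [← h.metric_xi_xi y hy, ← sum_metric_mul he hd (ξ y) (ξ y)]
    simp only [h.symm y hy (e _) (ξ y)]
  simp only [h1, h.sum_covBil he hd hy]
  rw [Finset.sum_neg_distrib, ← Finset.mul_sum, Finset.sum_comm]
  simp only [h3, h6, Finset.sum_sub_distrib, Finset.sum_neg_distrib, ← Finset.mul_sum, h8,
    Finset.sum_const, Finset.card_univ, nsmul_eq_mul, mul_one]
  ring

/-- The Ricci curvature of the Reeb field is controlled by the covariant derivative of `φ`. -/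
theorem einstein_bounds (hy : y ∈ U) {τ : ℝ}
    (hτ : ∀ u v, ∑ i, G y (R (e i) u v) (e i) = τ * G y u v) :
    0 ≤ -τ ∧ -τ ≤ ∑ j, ∑ i, G y (R (e j) (e i) (φ y (e i))) (φ y (e j))
        - τ * ((Fintype.card ι : ℝ) - 1) := by
  have h1 : -τ = ∑ i, G y (A y (e i)) (A y (e i)) := by
    have h2 := h.ricci_xi he hd hy
    rw [hτ, h.metric_xi_xi y hy] at h2
    linarith
  have hnn : ∀ v, 0 ≤ G y v v := fun v => by
    rcases eq_or_ne v 0 with rfl | hv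
    · simp
    · exact (h.pos y hy v hv).le
  refine ⟨h1 ▸ Finset.sum_nonneg fun i _ => hnn _, ?_⟩
  have h3 : 2 * -τ ≤ ∑ i, ∑ j, G y (B y (e i) (e j)) (B y (e i) (e j)) := by
    rw [h1, Finset.mul_sum]
    refine Finset.sum_le_sum fun i _ => ?_
    have h4 := two_mul_metric_le_sum he hd (h.pos y hy) (h.symm y hy)
      (h.metric_covEnd_skew hy (e i)) (h.metric_xi_xi y hy)
    -- `B_x ξ = -φ A x`, and `φ` is isometric on the complement of `ξ`, where `A x` lies.
    have h5 : G y (B y (e i) (ξ y)) (B y (e i) (ξ y)) = G y (A y (e i)) (A y (e i)) := by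
      rw [h.covEnd_xi hy]
      simp [h.skew y hy, h.phi_phi y hy, h.metric_covVec_xi hy]
    rwa [h5] at h4
  rw [h.sum_metric_covEnd he hd hy hτ] at h3
  linarith

/-- The `*`-Ricci form is skew. -/
theorem starRicci_skew (hy : y ∈ U) (u v : E) :
    ∑ i, G y (R u (e i) (φ y (e i))) v = -∑ i, G y (R v (e i) (φ y (e i))) u := by
  -- The first Bianchi identity shows `2 ρ*(u, v) = -∑ g(R(e_i, φ e_i) u, v)`, and each `R(e_i, φ
  -- e_i)` is skew.
  have key : ∀ u v, 2 * ∑ i, G y (R u (e i) (φ y (e i))) v =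
      -∑ i, G y (R (e i) (φ y (e i)) u) v := by
    intro u v
    have h1 := h.sum_phi_left he hd hy
      (LinearMap.mk₂ ℝ (fun a b => G y (R u a b) v)
        (fun a a' b => by simp [curvEnd_add_right]) (fun c a b => by simp [curvEnd_smul_right])
        (by simp) (by simp))
    simp only [LinearMap.mk₂_apply] at h1
    have h2 : ∀ i, G y (R (e i) (φ y (e i)) u) v =
        G y (R u (φ y (e i)) (e i)) v - G y (R u (e i) (φ y (e i))) v := by
      intro i
      have h3 := h.curvEnd_bianchi hy u (e i) (φ y (e i))
      rw [curvEnd_swap (φ y (e i)) u] at h3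
      have h4 := congrArg (fun a => G y a v) h3
      simp only [map_add, map_neg, add_apply, neg_apply, map_zero, zero_apply] at h4
      linarith
    simp only [h2, Finset.sum_sub_distrib, h1]
    ring
  have h1 := key u v
  have h2 := key v u
  simp only [h.curvEnd_skew hy _ _ u v, h.symm y hy u, Finset.sum_neg_distrib] at h1
  linarith

end Frame

end IsLocalCokahler

end LocalBochner

/-! ### From the manifold to a chart -/

section Transport

open Filter Topology

section ExteriorDerivative

variable {E : Type*} [NormedAddCommGroup E] [NormedSpace ℝ E] {y : E}

theorem extDeriv_oneForm {η : E → E [⋀^Fin 1]→L[ℝ] ℝ} (hη : DifferentiableAt ℝ η y) (u v : E) :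
    extDeriv η y ![u, v] =
      fderiv ℝ (fun z => η z ![v]) y u - fderiv ℝ (fun z => η z ![u]) y v := by
  have e1 : Fin.removeNth (0 : Fin (1 + 1)) ![u, v] = ![v] := by ext1 i; fin_cases i; rfl
  have e2 : Fin.removeNth (1 : Fin (1 + 1)) ![u, v] = ![u] := by ext1 i; fin_cases i; rfl
  refine (extDeriv_apply hη _).trans ((Fin.sum_univ_two _).trans ?_)
  rw [e1, e2]
  simp [sub_eq_add_neg]

theorem extDeriv_twoForm {η : E → E [⋀^Fin 2]→L[ℝ] ℝ} (hη : DifferentiableAt ℝ η y)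
    (u v w : E) :
    extDeriv η y ![u, v, w] = fderiv ℝ (fun z => η z ![v, w]) y u
      - fderiv ℝ (fun z => η z ![u, w]) y v + fderiv ℝ (fun z => η z ![u, v]) y w := by
  have e1 : Fin.removeNth (0 : Fin (2 + 1)) ![u, v, w] = ![v, w] := by
    ext1 i; fin_cases i <;> rfl
  have e2 : Fin.removeNth (1 : Fin (2 + 1)) ![u, v, w] = ![u, w] := by
    ext1 i; fin_cases i <;> rfl
  have e3 : Fin.removeNth (2 : Fin (2 + 1)) ![u, v, w] = ![u, v] := by
    ext1 i; fin_cases i <;> rfl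
  refine (extDeriv_apply hη _).trans ((Fin.sum_univ_three _).trans ?_)
  rw [e1, e2, e3]
  simp [sub_eq_add_neg]

end ExteriorDerivative

section Curvature

variable {m : ℕ} {M : Type*} [TopologicalSpace M] [ChartedSpace (EuclideanSpace ℝ (Fin m)) M]
  [IsManifold (𝓡 m) ∞ M]

theorem isLocalMetric_metricInChart (g : Metric m M) (p : M) :
    IsLocalMetric (extChartAt (𝓡 m) p).target (metricInChart g p) where
  isOpen := isOpen_extChartAt_target p
  contDiffOn := contDiffOn_metricInChart g p
  symm y _ u v := g.symm _ _ _
  pos y hy v hv := by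
    refine g.pos _ _ fun h0 => hv ?_
    exact (chartDeriv_chartInvDeriv hy v).symm.trans ((congrArg _ h0).trans (map_zero _))

theorem chartDeriv_self (p : M) (v : TangentSpace (𝓡 m) p) : chartDeriv p p v = v := by
  have := isManifold_one (m := m) (M := M)
  rw [chartDeriv, mfderiv_extChartAt_self]
  rfl

theorem chartInvDeriv_self (p : M) (v : EuclideanSpace ℝ (Fin m)) :
    chartInvDeriv p (extChartAt (𝓡 m) p p) v = v := by
  have := isManifold_one (m := m) (M := M)
  have h := mfderivWithin_range_extChartAt_symm (I := 𝓡 m) (x := p)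
  simp only [modelWithCornersSelf_coe, Set.range_id, mfderivWithin_univ] at h
  exact DFunLike.congr_fun h v

theorem metricInChart_self (g : Metric m M) (p : M) (u v : TangentSpace (𝓡 m) p) :
    metricInChart g p (extChartAt (𝓡 m) p p) u v = g.inner p u v := by
  -- The base point `(extChartAt _ p).symm (extChartAt _ p p)` equals `p` only propositionally, so
  -- the tangent space is generalized over `q` before substituting.
  have key : ∀ q : M, q = p → ∀ u v : EuclideanSpace ℝ (Fin m),
      g.inner q (u : TangentSpace (𝓡 m) q) (v : TangentSpace (𝓡 m) q) =
        g.inner p (u : TangentSpace (𝓡 m) p) (v : TangentSpace (𝓡 m) p) := by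
    rintro q rfl u v
    rfl
  refine Eq.trans ?_ (key _ (extChartAt_to_inv (I := 𝓡 m) p) u v)
  refine (metricInChart_apply g p _ u v).trans ?_
  rw [chartInvDeriv_self (m := m) p u, chartInvDeriv_self (m := m) p v]

theorem curvature_eq (g : Metric m M) (p : M) (u v w : TangentSpace (𝓡 m) p) :
    curvature g p u v w =
      curvEnd (christoffelCLM (metricInChart g p)) (extChartAt (𝓡 m) p p) u v w := by
  have h1 : curvature g p u v w = chartInvDeriv p (extChartAt (𝓡 m) p p)
    (localCurvature (metricInChart g p) (extChartAt (𝓡 m) p p) (chartDeriv p p u)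
      (chartDeriv p p v) (chartDeriv p p w)) := rfl
  rw [h1, chartInvDeriv_self, chartDeriv_self, chartDeriv_self, chartDeriv_self]
  exact (isLocalMetric_metricInChart g p).localCurvature_eq (mem_extChartAt_target p) u v w

theorem frame_spec (g : Metric m M) (p : M) (i j : Fin m) :
    g.inner p (frame g p i) (frame g p j) = if i = j then 1 else 0 :=
  (exists_orthonormalFrame g p).choose_spec i j

end Curvature

namespace AlmostContactMetricStructure

variable {n : ℕ} {M : Type*} [TopologicalSpace M]
  [ChartedSpace (EuclideanSpace ℝ (Fin (2 * n + 1))) M] [IsManifold (𝓡 (2 * n + 1)) ∞ M]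
  (S : AlmostContactMetricStructure n M)

/-- From `φ² ξ = 0`, the formula for `φ²` at `φ ξ` gives `φ ξ = c ξ`. Applying `φ` again gives `c φ
ξ = 0`, so `φ ξ = 0` in either case. -/
theorem phi_xi (x : M) : S.phi x (S.xi x) = 0 := by
  have h1 : S.phi x (S.phi x (S.xi x)) = 0 := by
    rw [S.phi_phi, S.alpha_xi, one_smul, neg_add_cancel]
  have h2 := S.phi_phi x (S.phi x (S.xi x))
  rw [h1, map_zero] at h2
  have h3 : S.phi x (S.xi x) = S.alpha x ![S.phi x (S.xi x)] • S.xi x :=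
    (neg_add_eq_zero.mp h2.symm)
  have h4 := congrArg (S.phi x) h3
  rw [h1, map_smul] at h4
  rcases smul_eq_zero.mp h4.symm with h5 | h5
  · rw [h3, h5, zero_smul]
  · exact h5

theorem alpha_eq (x : M) (v : TangentSpace (𝓡 (2 * n + 1)) x) :
    S.alpha x ![v] = S.g.inner x (S.xi x) v := by
  have h1 := S.g_phi_phi x (S.xi x) v
  rw [S.phi_xi, map_zero, zero_apply, S.alpha_xi, one_mul] at h1
  linarith

theorem inner_phi (x : M) (u v : TangentSpace (𝓡 (2 * n + 1)) x) :
    S.g.inner x (S.phi x u) v = -S.g.inner x u (S.phi x v) := by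
  rw [S.g.symm x u, ← S.omega_eq, ← S.omega_eq]
  have h1 := (S.omega x).toAlternatingMap.map_swap ![u, v] (i := 0) (j := 1) (by simp)
  have h2 : ![u, v] ∘ Equiv.swap (0 : Fin 2) 1 = ![v, u] := by
    ext i; fin_cases i <;> simp
  rw [h2] at h1
  exact (neg_eq_iff_eq_neg.mpr h1).symm

/-- The Reeb field in the preferred chart at `p`. -/
def xiInChart (p : M) (y : EuclideanSpace ℝ (Fin (2 * n + 1))) :
    EuclideanSpace ℝ (Fin (2 * n + 1)) :=
  chartDeriv p ((extChartAt (𝓡 (2 * n + 1)) p).symm y)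
    (S.xi ((extChartAt (𝓡 (2 * n + 1)) p).symm y))

/-- The endomorphism `φ` in the preferred chart at `p`. -/
def phiInChart (p : M) (y : EuclideanSpace ℝ (Fin (2 * n + 1))) :
    EuclideanSpace ℝ (Fin (2 * n + 1)) →L[ℝ] EuclideanSpace ℝ (Fin (2 * n + 1)) :=
  chartDeriv p ((extChartAt (𝓡 (2 * n + 1)) p).symm y) ∘L
    S.phi ((extChartAt (𝓡 (2 * n + 1)) p).symm y) ∘L chartInvDeriv p y

variable {p : M} {y : EuclideanSpace ℝ (Fin (2 * n + 1))}

theorem chartInvDeriv_xiInChart (hy : y ∈ (extChartAt (𝓡 (2 * n + 1)) p).target) :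
    chartInvDeriv p y (S.xiInChart p y) = S.xi ((extChartAt (𝓡 (2 * n + 1)) p).symm y) :=
  chartInvDeriv_chartDeriv hy _

theorem chartInvDeriv_phiInChart (hy : y ∈ (extChartAt (𝓡 (2 * n + 1)) p).target)
    (v : EuclideanSpace ℝ (Fin (2 * n + 1))) :
    chartInvDeriv p y (S.phiInChart p y v) =
      S.phi ((extChartAt (𝓡 (2 * n + 1)) p).symm y) (chartInvDeriv p y v) :=
  chartInvDeriv_chartDeriv hy _

theorem alpha_inChart (hy : y ∈ (extChartAt (𝓡 (2 * n + 1)) p).target)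
    (v : EuclideanSpace ℝ (Fin (2 * n + 1))) :
    S.alpha.inChart p y ![v] = metricInChart S.g p y (S.xiInChart p y) v := by
  rw [metricInChart_apply, S.chartInvDeriv_xiInChart hy, ← S.alpha_eq]
  have : (chartInvDeriv p y) ∘ ![v] = ![chartInvDeriv p y v] := by
    ext1 i; fin_cases i; rfl
  rw [← this]
  rfl

theorem omega_inChart (hy : y ∈ (extChartAt (𝓡 (2 * n + 1)) p).target)
    (u v : EuclideanSpace ℝ (Fin (2 * n + 1))) :
    S.omega.inChart p y ![u, v] = metricInChart S.g p y (S.phiInChart p y u) v := by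
  rw [metricInChart_apply, S.chartInvDeriv_phiInChart hy, ← S.omega_eq]
  have : (chartInvDeriv p y) ∘ ![u, v] = ![chartInvDeriv p y u, chartInvDeriv p y v] := by
    ext1 i; fin_cases i <;> rfl
  rw [← this]
  rfl

omit [IsManifold (𝓡 (2 * n + 1)) ∞ M] in
theorem eventually_mem_target (hy : y ∈ (extChartAt (𝓡 (2 * n + 1)) p).target) :
    ∀ᶠ z in 𝓝 y, z ∈ (extChartAt (𝓡 (2 * n + 1)) p).target :=
  (isOpen_extChartAt_target p).mem_nhds hy

/-- Smoothness of `ξ` is not a field of the structure: it follows from that of `α` and `g`, since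
`ξ` is the metric dual of `α`. The same holds for `φ` and `ω`. -/
theorem contDiffOn_xiInChart (p : M) :
    ContDiffOn ℝ ∞ (S.xiInChart p) (extChartAt (𝓡 (2 * n + 1)) p).target := by
  have hm := isLocalMetric_metricInChart S.g p
  have h1 : ContDiffOn ℝ ∞ (fun z => metricInChart S.g p z (S.xiInChart p z))
      (extChartAt (𝓡 (2 * n + 1)) p).target := by
    rw [contDiffOn_clm_apply]
    intro v
    refine ContDiffOn.congr (f := fun z => S.alpha.inChart p z ![v]) ?_
      fun z hz => (S.alpha_inChart hz v).symm
    exact (ContinuousAlternatingMap.apply ℝ _ ℝ ![v]).contDiff.comp_contDiffOn (S.smooth_alpha p)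
  refine (hm.contDiffOn_inverse.clm_apply h1).congr fun z hz => ?_
  exact ((isInvertible_of_posDef (hm.pos z hz)).inverse_apply_self _).symm

theorem contDiffOn_phiInChart (p : M) :
    ContDiffOn ℝ ∞ (S.phiInChart p) (extChartAt (𝓡 (2 * n + 1)) p).target := by
  have hm := isLocalMetric_metricInChart S.g p
  rw [contDiffOn_clm_apply]
  intro u
  have h1 : ContDiffOn ℝ ∞ (fun z => metricInChart S.g p z (S.phiInChart p z u))
      (extChartAt (𝓡 (2 * n + 1)) p).target := by
    rw [contDiffOn_clm_apply]
    intro v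
    refine ContDiffOn.congr (f := fun z => S.omega.inChart p z ![u, v]) ?_
      fun z hz => (S.omega_inChart hz u v).symm
    exact (ContinuousAlternatingMap.apply ℝ _ ℝ ![u, v]).contDiff.comp_contDiffOn
      (S.smooth_omega p)
  refine (hm.contDiffOn_inverse.clm_apply h1).congr fun z hz => ?_
  exact ((isInvertible_of_posDef (hm.pos z hz)).inverse_apply_self _).symm

theorem metricInChart_phiInChart (hy : y ∈ (extChartAt (𝓡 (2 * n + 1)) p).target)
    (u v : EuclideanSpace ℝ (Fin (2 * n + 1))) :
    metricInChart S.g p y (S.phiInChart p y u) v =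
      -metricInChart S.g p y u (S.phiInChart p y v) := by
  rw [metricInChart_apply, metricInChart_apply, S.chartInvDeriv_phiInChart hy,
    S.chartInvDeriv_phiInChart hy, S.inner_phi]

theorem isLocalCokahler (hS : S.IsAlmostCokahler) (p : M) :
    IsLocalCokahler (extChartAt (𝓡 (2 * n + 1)) p).target (metricInChart S.g p)
      (S.xiInChart p) (S.phiInChart p) where
  toIsLocalMetric := isLocalMetric_metricInChart S.g p
  contDiffOn_xi := S.contDiffOn_xiInChart p
  contDiffOn_phi := S.contDiffOn_phiInChart p
  metric_xi_xi y hy := by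
    rw [← S.alpha_inChart hy, ← S.alpha_xi ((extChartAt (𝓡 (2 * n + 1)) p).symm y),
      S.alpha_inChart hy, metricInChart_apply, S.chartInvDeriv_xiInChart hy, S.alpha_eq]
  skew y hy u v := S.metricInChart_phiInChart hy u v
  phi_phi y hy v := by
    have h1 : S.phiInChart p y (S.phiInChart p y v) =
        chartDeriv p ((extChartAt (𝓡 (2 * n + 1)) p).symm y)
          (S.phi _ (S.phi _ (chartInvDeriv p y v))) := by
      rw [← S.chartInvDeriv_phiInChart hy]
      rfl
    rw [h1, S.phi_phi, map_add, map_neg, map_smul, chartDeriv_chartInvDeriv hy, S.alpha_eq,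
      metricInChart_apply, S.chartInvDeriv_xiInChart hy, S.g.symm]
    rfl
  closed_alpha y hy u v := by
    have hd : DifferentiableAt ℝ (S.alpha.inChart p) y :=
      ((S.smooth_alpha p).contDiffAt (eventually_mem_target hy)).differentiableAt (by simp)
    have h1 := congrArg (fun a => a ![u, v]) (hS.1 p y hy)
    have key : ∀ w, (fun z => S.alpha.inChart p z ![w]) =ᶠ[𝓝 y]
        fun z => metricInChart S.g p z (S.xiInChart p z) w := fun w =>
      (eventually_mem_target hy).mono fun z hz => S.alpha_inChart hz w
    simp only [extDeriv_oneForm hd, (key _).fderiv_eq] at h1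
    exact sub_eq_zero.mp h1
  closed_omega y hy u v w := by
    have hd : DifferentiableAt ℝ (S.omega.inChart p) y :=
      ((S.smooth_omega p).contDiffAt (eventually_mem_target hy)).differentiableAt (by simp)
    have h1 := congrArg (fun a => a ![u, v, w]) (hS.2 p y hy)
    have key : ∀ a b, (fun z => S.omega.inChart p z ![a, b]) =ᶠ[𝓝 y]
        fun z => metricInChart S.g p z (S.phiInChart p z a) b := fun a b =>
      (eventually_mem_target hy).mono fun z hz => S.omega_inChart hz a b
    -- The exterior derivative carries the middle term as `-ω(u, w)`; skewness brings it to the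
    -- cyclic form.
    have hs : (fun z => metricInChart S.g p z (S.phiInChart p z u) w) =ᶠ[𝓝 y]
        fun z => -metricInChart S.g p z (S.phiInChart p z w) u :=
      (eventually_mem_target hy).mono fun z hz => by
        beta_reduce
        rw [(isLocalMetric_metricInChart S.g p).symm z hz (S.phiInChart p z w)]
        exact S.metricInChart_phiInChart hz u w
    simp only [extDeriv_twoForm hd, (key _ _).fderiv_eq, hs.fderiv_eq, fderiv_fun_neg] at h1
    rw [neg_apply, sub_neg_eq_add] at h1
    exact h1

end AlmostContactMetricStructure

end Transport

/-! ### Curvature traces on the manifold and the conclusion -/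

namespace AlmostContactMetricStructure

variable {n : ℕ} {M : Type*} [TopologicalSpace M]
  [ChartedSpace (EuclideanSpace ℝ (Fin (2 * n + 1))) M] [IsManifold (𝓡 (2 * n + 1)) ∞ M]
  (S : AlmostContactMetricStructure n M)

theorem phiInChart_self (p : M) (v : TangentSpace (𝓡 (2 * n + 1)) p) :
    S.phiInChart p (extChartAt (𝓡 (2 * n + 1)) p p) v = S.phi p v := by
  have key : ∀ q : M, q = p → ∀ v : EuclideanSpace ℝ (Fin (2 * n + 1)),
      chartDeriv p q (S.phi q (v : TangentSpace (𝓡 (2 * n + 1)) q)) =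
        S.phi p (v : TangentSpace (𝓡 (2 * n + 1)) p) := by
    rintro q rfl v
    exact chartDeriv_self q _
  refine Eq.trans ?_ (key _ (extChartAt_to_inv (I := 𝓡 (2 * n + 1)) p) v)
  exact congrArg (fun w => chartDeriv p _ (S.phi _ w)) (chartInvDeriv_self p v)

theorem starRicciForm_eq (p : M) (u v : TangentSpace (𝓡 (2 * n + 1)) p) :
    S.starRicciForm p u v = ∑ i, metricInChart S.g p (extChartAt (𝓡 (2 * n + 1)) p p)
      (curvEnd (christoffelCLM (metricInChart S.g p)) (extChartAt (𝓡 (2 * n + 1)) p p) u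
        (frame S.g p i)
        (S.phiInChart p (extChartAt (𝓡 (2 * n + 1)) p p) (frame S.g p i))) v := by
  refine Finset.sum_congr rfl fun i _ => ?_
  refine (metricInChart_self S.g p _ v).symm.trans ?_
  rw [curvature_eq]
  exact congrArg (fun w => metricInChart S.g p (extChartAt (𝓡 (2 * n + 1)) p p)
    (curvEnd (christoffelCLM (metricInChart S.g p)) (extChartAt (𝓡 (2 * n + 1)) p p) u
      (frame S.g p i) w) v)
    (S.phiInChart_self p (frame S.g p i)).symm

end AlmostContactMetricStructure

theorem ricci_eq {m : ℕ} {M : Type*} [TopologicalSpace M]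
    [ChartedSpace (EuclideanSpace ℝ (Fin m)) M] [IsManifold (𝓡 m) ∞ M] (g : Metric m M) (p : M)
    (u v : TangentSpace (𝓡 m) p) :
    ricci g p u v = ∑ i, metricInChart g p (extChartAt (𝓡 m) p p)
      (curvEnd (christoffelCLM (metricInChart g p)) (extChartAt (𝓡 m) p p) (frame g p i) u v)
      (frame g p i) := by
  refine Finset.sum_congr rfl fun i _ => ?_
  refine (metricInChart_self g p _ _).symm.trans ?_
  rw [curvature_eq]

theorem sum_sum_eq_two_mul_sum_Ioi {m : ℕ} (F : Fin m → Fin m → ℝ) (hs : ∀ i j, F i j = F j i)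
    (h0 : ∀ i, F i i = 0) : ∑ i, ∑ j, F i j = 2 * ∑ i, ∑ j ∈ Finset.Ioi i, F i j := by
  have h1 := Finset.sum_sum_Ioi_add_eq_sum_sum_off_diag (fun i j => F j i)
  have h2 : ∀ i, ∑ j, F i j = ∑ j ∈ {i}ᶜ, F i j := fun i => by
    rw [← Finset.sum_compl_add_sum {i}, Finset.sum_singleton, h0, add_zero]
  simp only [h2, ← h1, Finset.mul_sum]
  refine Finset.sum_congr rfl fun i _ => Finset.sum_congr rfl fun j _ => ?_
  rw [hs j i]
  ring

namespace AlmostContactMetricStructure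

variable {n : ℕ} {M : Type*} [TopologicalSpace M]
  [ChartedSpace (EuclideanSpace ℝ (Fin (2 * n + 1))) M] [IsManifold (𝓡 (2 * n + 1)) ∞ M]
  (S : AlmostContactMetricStructure n M)

theorem metricInChart_frame (p : M) (i j : Fin (2 * n + 1)) :
    metricInChart S.g p (extChartAt (𝓡 (2 * n + 1)) p p) (frame S.g p i) (frame S.g p j) =
      if i = j then 1 else 0 :=
  (metricInChart_self S.g p _ _).trans (frame_spec S.g p i j)

/-- `2 ⟨ω, ρ*⟩` as the double trace of the curvature contracted with `φ`. -/
theorem two_mul_twoFormInner (hS : S.IsAlmostCokahler) (p : M) :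
    2 * twoFormInner S.g p (fun u v => S.omega p ![u, v]) (S.starRicciForm p) =
      ∑ j, ∑ i, metricInChart S.g p (extChartAt (𝓡 (2 * n + 1)) p p)
        (curvEnd (christoffelCLM (metricInChart S.g p)) (extChartAt (𝓡 (2 * n + 1)) p p)
          (frame S.g p j) (frame S.g p i)
          (S.phiInChart p (extChartAt (𝓡 (2 * n + 1)) p p) (frame S.g p i)))
        (S.phiInChart p (extChartAt (𝓡 (2 * n + 1)) p p) (frame S.g p j)) := by
  have h := S.isLocalCokahler hS p
  have hy := mem_extChartAt_target (I := 𝓡 (2 * n + 1)) p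
  have he := S.metricInChart_frame p
  have hd : Fintype.card (Fin (2 * n + 1)) =
    Module.finrank ℝ (EuclideanSpace ℝ (Fin (2 * n + 1))) := by simp
  have hω : ∀ u v, S.omega p ![u, v] = -S.omega p ![v, u] := fun u v => by
    rw [S.omega_eq, S.omega_eq, S.inner_phi, S.g.symm]
  have hρ : ∀ u v, S.starRicciForm p u v = -S.starRicciForm p v u := fun u v => by
    rw [S.starRicciForm_eq, S.starRicciForm_eq]
    exact h.starRicci_skew he hd hy u v
  rw [twoFormInner, ← sum_sum_eq_two_mul_sum_Ioi
    -- A product of two skew forms is symmetric with zero diagonal, so the sum over `i < j` is half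
    -- of the full double sum.
    (fun i j => S.omega p ![frame S.g p i, frame S.g p j]
      * S.starRicciForm p (frame S.g p i) (frame S.g p j))
    (fun i j => by rw [hω, hρ]; ring)
    (fun i => by have := hω (frame S.g p i) (frame S.g p i); rw [self_eq_neg.mp this, zero_mul])]
  refine Finset.sum_congr rfl fun j _ => ?_
  have h1 : ∀ i, S.omega p ![frame S.g p j, frame S.g p i] =
      metricInChart S.g p (extChartAt (𝓡 (2 * n + 1)) p p)
        (S.phiInChart p (extChartAt (𝓡 (2 * n + 1)) p p) (frame S.g p j)) (frame S.g p i) := by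
    intro i
    rw [S.omega_eq]
    refine (metricInChart_self S.g p _ _).symm.trans ?_
    exact congrArg (fun w => metricInChart S.g p _ w (frame S.g p i))
      (S.phiInChart_self p (frame S.g p j)).symm
  refine (Finset.sum_congr rfl fun i _ => congrArg₂ (· * ·) (h1 i) (S.starRicciForm_eq p _ _)).trans
    ?_
  -- Contracting `ω(e_j, ·) = g(φ e_j, ·)` with `ρ*(e_j, ·)` over the frame evaluates the latter at
  -- `φ e_j`.
  exact sum_metric_mul_sum he hd _ _

theorem scalarCurvature_eq {τ : ℝ} (hτ : IsEinstein S.g τ) (p : M) :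
    scalarCurvature S.g p = (2 * n + 1) * τ := by
  simp [scalarCurvature, hτ p, frame_spec]

theorem einstein_bounds (hS : S.IsAlmostCokahler) {τ : ℝ} (hτ : IsEinstein S.g τ) (p : M) :
    0 ≤ -τ ∧
      -τ ≤ 2 * twoFormInner S.g p (fun u v => S.omega p ![u, v]) (S.starRicciForm p)
        - 2 * n * τ := by
  have h := S.isLocalCokahler hS p
  have hd : Fintype.card (Fin (2 * n + 1)) =
    Module.finrank ℝ (EuclideanSpace ℝ (Fin (2 * n + 1))) := by simp
  have h1 := h.einstein_bounds (S.metricInChart_frame p) hd (mem_extChartAt_target p) (τ := τ)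
    fun u v => (ricci_eq S.g p u v).symm.trans
      ((hτ p u v).trans (congrArg (τ * ·) (metricInChart_self S.g p u v).symm))
  rw [← S.two_mul_twoFormInner hS p, Fintype.card_fin] at h1
  push_cast at h1
  refine ⟨h1.1, h1.2.trans_eq ?_⟩
  ring

end AlmostContactMetricStructure
end CK

end

theorem proposition3p3 {n : ℕ} {M : Type*} [TopologicalSpace M] [T2Space M]
    [SecondCountableTopology M] [ChartedSpace (EuclideanSpace ℝ (Fin (2 * n + 1))) M]
    [IsManifold (𝓡 (2 * n + 1)) ∞ M] (S : CK.AlmostContactMetricStructure n M)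
    (hS : S.IsAlmostCokahler) (τ : ℝ) (hτ : CK.IsEinstein S.g τ) (p : M) :
    0 ≤ -τ ∧ -τ ≤ 2 * (n : ℝ) * (S.tauStar p - τ) ∧ CK.scalarCurvature S.g p ≤ 0 := by
  obtain ⟨h1, h2⟩ := S.einstein_bounds hS hτ p
  refine ⟨h1, ?_, ?_⟩
  -- For `n = 0` the factor `1 / n` is `0` by convention. In dimension one there are no pairs `i <
  -- j`, so the local bound already reads `-τ ≤ 0`.
  · rcases Nat.eq_zero_or_pos n with rfl | hn
    · have h3 : CK.twoFormInner S.g p (fun u v => S.omega p ![u, v]) (S.starRicciForm p) = 0 := by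
        refine Finset.sum_eq_zero fun i _ => Finset.sum_eq_zero fun j hj => ?_
        have hij := Finset.mem_Ioi.mp hj
        omega
      rw [h3] at h2
      simpa using h2
    · have hn' : (n : ℝ) ≠ 0 := by positivity
      refine h2.trans_eq ?_
      rw [CK.AlmostContactMetricStructure.tauStar]
      field_simp
  · rw [S.scalarCurvature_eq hτ p]
    have : (0 : ℝ) ≤ 2 * n + 1 := by positivity
    nlinarith
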